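/- Let $p$ be an odd prime and let $K$ be a $p$-adic field (a finite extension of $\mathbb{Q}_p$) with valuation ring $R$, uniformizer $\pi$, residue field of order $q$, normalized valuation $v_\pi$ (with $v_\pi(0)=\infty$) and absolute value $|a|=q^{-v_\pi(a)}$. A quadratic form over $R$ is a form $xMx^T$ with $M$ a symmetric matrix over $R$; it is unimodular of rank $r$ and discriminant $d$ if $M$ is an $r\times r$ matrix whose determinant is a unit lying in the class $d$ modulo squares of units (the zero form has rank $0$ and discriminant $1$). Write $\bigoplus$ and $\oplus$ for sums of polynomials no two of which share an indeterminate. For $f\in R[x_1,\dots,x_n]$ let $$Z_f=\int_{R^n}|f(x)|^s\,dx,\qquad s\in\mathbb{C},\ \operatorname{Re}(s)>0,$$ where $dx$ is the Haar measure with total volume $1$ on $R^n$, and regard $Z_f=Z_f(t)$ as a function of $t=q^{-s}$. For $b\in R$ let $\eta(b)=1$ if $b$ is the square of a unit, $\eta(b)=-1$ if $b$ is any other unit, and $\eta(b)=0$ if $\pi\mid b$. For $a\in R$, $r\in\mathbb{N}=\{0,1,2,\dots\}$ and a unit $d$ put $g=\frac{1-1/q}{1-t/q}$ and define $I_a(r,d)$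 as follows. If $r$ is odd, put $\varepsilon=\eta\bigl(a(-1)^{(r+1)/2}d\bigr)/q^{(r+1)/2}$ and $$I_a(r,d)=\begin{cases}\bigl(1-\frac{t}{q^r}\bigr)g & \text{if } \pi\mid a,\\ (1+\varepsilon t)\,g-\frac{1}{q^r}-\varepsilon & \text{if } \pi\nmid a.\end{cases}$$ If $r$ is even, put $\varepsilon=\eta\bigl((-1)^{r/2}d\bigr)/q^{r/2}$ and $$I_a(r,d)=\begin{cases}(1-\varepsilon)(1+\varepsilon t)\,g & \text{if } \pi\mid a,\\ (1-\varepsilon)(g+\varepsilon) & \text{if } \pi\nmid a.\end{cases}$$ **Theorem.** Consider the polynomial $Q=\bigoplus_{i\in\mathbb{N}}\pi^iQ_i\oplus L+c$, where each $Q_i$ is a unimodular quadratic form over $R$ of rank $r_i$ and discriminant $d_i$, there is a positive integer $\omega$ with $Q_i=0$ for $i>\omega$, $L$ is a linear form over $R$ involving at most one indeterminate, and $c\in R$. For $j\in\mathbb{N}$ let $$r_{(j)}=\sum_{\substack{0\le i\le j\\ i\equiv j\ (\mathrm{mod}\ 2)}}r_i,\qquad d_{(j)}=\prod_{\substack{0\le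 i\le j\\ i\equiv j\ (\mathrm{mod}\ 2)}}d_i,\qquad q_{(j)}=q^{\sum_{0\le i<j}r_{(i)}}.$$ Then the integral defining $Z_Q$ converges absolutely for $\operatorname{Re}(s)>0$, and: 1. If $L=0$ and $c=0$, then, with $r=\sum_i r_i$, $$Z_Q(t)=\sum_{0\le i<\omega-1}\frac{t^i}{q_{(i)}}I_0(r_{(i)},d_{(i)})+\left(\frac{t^{\omega-1}}{q_{(\omega-1)}}I_0(r_{(\omega-1)},d_{(\omega-1)})+\frac{t^{\omega}}{q_{(\omega)}}I_0(r_{(\omega)},d_{(\omega)})\right)\left(1-\frac{t^2}{q^r}\right)^{-1}.$$ 2. If $L=bx$ with $v_\pi(b)=\lambda<\infty$ and $v_\pi(b)\le v_\pi(c)$, then $$Z_Q(t)=\sum_{0\le i<\lambda}\frac{t^i}{q_{(i)}}I_0(r_{(i)},d_{(i)})+\frac{t^\lambda}{q_{(\lambda)}}\cdot\frac{1-1/q}{1-t/q}.$$ 3. If $L=bx$ with $v_\pi(b)>v_\pi(c)=\kappa$ (this includes the case $L=0$, $c\ne0$, where $b=0$), then $$Z_Q(t)=\sum_{0\le i\le\kappa}\frac{t^i}{q_{(i)}}I_{c/\pi^i}(r_{(i)},d_{(i)})+\frac{t^\kappa}{q_{(\kappa+1)}}.$$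 -/

import Mathlib

open MeasureTheory MvPolynomial
open scoped ValuativeRel

namespace Igusa

/-! ### Valuation, absolute value and the local zeta function

Here `R` stands for the valuation ring of a `p`-adic field. -/

section Zeta

/-- The cardinality `q` of the residue field of `R`. -/
noncomputable def residueCard (R : Type*) [CommRing R] [IsLocalRing R] : ℕ :=
  Nat.card (IsLocalRing.ResidueField R)

/-- The normalized valuation `v_π` on `R`, with `v_π 0 = ⊤`. -/
noncomputable def val {R : Type*} [CommRing R] [IsDomain R] [IsDiscreteValuationRing R]
    (a : R) : ℕ∞ :=
  IsDiscreteValuationRing.addVal R a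

open Classical in
/-- The absolute value `|a| = q ^ (- v_π a)`, with `|0| = 0`. -/
noncomputable def absVal {R : Type*} [CommRing R] [IsDomain R] [IsDiscreteValuationRing R]
    (a : R) : ℝ :=
  if a = 0 then 0 else ((residueCard R : ℝ) ^ (val a).toNat)⁻¹

/-- The Haar measure on the compact group `R ^ σ`, normalized to have total volume `1`:
the product of the normalized Haar measures of the factors. -/
noncomputable def haar (R : Type*) [CommRing R] [TopologicalSpace R] [IsTopologicalRing R]
    [CompactSpace R] [MeasurableSpace R] [BorelSpace R] (σ : Type*) [Fintype σ] :
    Measure (σ → R) :=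
  Measure.pi fun _ : σ => Measure.addHaarMeasure (⊤ : TopologicalSpace.PositiveCompacts R)

/-- The integrand `|f x| ^ s` of the Igusa local zeta function. -/
noncomputable def integrand {R : Type*} [CommRing R] [IsDomain R] [IsDiscreteValuationRing R]
    {σ : Type*} (f : MvPolynomial σ R) (s : ℂ) (x : σ → R) : ℂ :=
  (absVal (eval x f) : ℂ) ^ s

/-- The Igusa local zeta function `Z_f s = ∫_{R ^ σ} |f x| ^ s dx`. -/
noncomputable def zeta {R : Type*} [CommRing R] [IsDomain R] [IsDiscreteValuationRing R]
    [TopologicalSpace R] [IsTopologicalRing R] [CompactSpace R] [MeasurableSpace R] [BorelSpace R]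
    {σ : Type*} [Fintype σ] (f : MvPolynomial σ R) (s : ℂ) : ℂ :=
  ∫ x, integrand f s x ∂(haar R σ)

end Zeta

/-! ### Unimodular quadratic forms and linear forms -/

section Forms

/-- The quadratic form `∑ M i j * x_{e i} * x_{e j}` with matrix `M` in the indeterminates
`x_{e 0}, …, x_{e (r - 1)}`. -/
noncomputable def formOfMatrix {R : Type*} [CommRing R] {σ : Type*} {r : ℕ} (e : Fin r ↪ σ)
    (M : Matrix (Fin r) (Fin r) R) : MvPolynomial σ R :=
  ∑ i, ∑ j, C (M i j) * X (e i) * X (e j)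

/-- `P` is a unimodular quadratic form of rank `r` in (some of) the indeterminates indexed by `σ`,
and its discriminant is the class of the unit `d` modulo squares of units. The zero form has
rank `0` and discriminant `1`. -/
def IsUnimodularForm {R : Type*} [CommRing R] {σ : Type*} (P : MvPolynomial σ R) (r : ℕ)
    (d : Rˣ) : Prop :=
  ∃ (e : Fin r ↪ σ) (M : Matrix (Fin r) (Fin r) R),
    M.IsSymm ∧ P = formOfMatrix e M ∧ ∃ u : Rˣ, M.det = (d : R) * (u : R) ^ 2

/-- `L` is a linear form involving at most one indeterminate, with coefficient `b`; the zero form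
in no indeterminate has `b = 0`. -/
def IsLinearInOneVar {R : Type*} [CommRing R] {σ : Type*} (L : MvPolynomial σ R) (b : R) : Prop :=
  (L = 0 ∧ b = 0) ∨ ∃ x : σ, L = C b * X x

end Forms

/-! ### The data attached to a sequence of ranks and discriminants -/

section Data

/-- `r_(j)`: the sum of the `r i` with `0 ≤ i ≤ j` and `i ≡ j (mod 2)`. -/
def rankTo (r : ℕ → ℕ) (j : ℕ) : ℕ :=
  ∑ i ∈ (Finset.range (j + 1)).filter (fun i => i % 2 = j % 2), r i

/-- `d_(j)`: the product of the `d i` with `0 ≤ i ≤ j` and `i ≡ j (mod 2)`. -/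
def discTo {R : Type*} [CommRing R] (d : ℕ → Rˣ) (j : ℕ) : Rˣ :=
  ∏ i ∈ (Finset.range (j + 1)).filter (fun i => i % 2 = j % 2), d i

/-- `q_(j)`: the power of `q` with exponent the sum of the `r_(i)` with `0 ≤ i < j`. -/
def cardTo (q : ℕ) (r : ℕ → ℕ) (j : ℕ) : ℕ :=
  q ^ ∑ i ∈ Finset.range j, rankTo r i

end Data

/-! ### The functions `I_a(r, d)` -/

section Table

open Classical in
/-- The quadratic character: `1` on squares of units, `-1` on the other units, `0` on nonunits. -/
noncomputable def eta {R : Type*} [CommRing R] (b : R) : ℤ :=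
  if IsUnit b then (if ∃ u : Rˣ, b = (u : R) ^ 2 then 1 else -1) else 0

/-- The term `(1 - 1/q) / (1 - t/q)`. -/
noncomputable def geom (q : ℕ) (t : ℂ) : ℂ :=
  (1 - 1 / (q : ℂ)) / (1 - t / (q : ℂ))

open Classical in
/-- The functions `I_a(r, d)` of `t`; the condition `π ∣ a` is expressed as `a` lying in the
maximal ideal. -/
noncomputable def tableI {R : Type*} [CommRing R] [IsLocalRing R] (a : R) (r : ℕ) (d : R)
    (t : ℂ) : ℂ :=
  let q : ℕ := residueCard R
  if Odd r then
    if a ∈ IsLocalRing.maximalIdeal R then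
      (1 - t / (q : ℂ) ^ r) * geom q t
    else
      let ε : ℂ := ((eta (a * (-1) ^ ((r + 1) / 2) * d) : ℤ) : ℂ) / (q : ℂ) ^ ((r + 1) / 2)
      (1 + ε * t) * geom q t - 1 / (q : ℂ) ^ r - ε
  else
    let ε : ℂ := ((eta ((-1) ^ (r / 2) * d) : ℤ) : ℂ) / (q : ℂ) ^ (r / 2)
    if a ∈ IsLocalRing.maximalIdeal R then
      (1 - ε) * (1 + ε * t) * geom q t
    else
      (1 - ε) * (geom q t + ε)

open Classical in
/-- The quotient `c / π ^ i` in `R`, for `π ^ i ∣ c`; set to `0` otherwise. -/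
noncomputable def divPow {R : Type*} [CommRing R] (π c : R) (i : ℕ) : R :=
  if h : π ^ i ∣ c then h.choose else 0

theorem pow_mul_divPow {R : Type*} [CommRing R] {π c : R} {i : ℕ} (h : π ^ i ∣ c) :
    π ^ i * divPow π c i = c := by
  rw [divPow, dif_pos h]
  exact h.choose_spec.symm

/-- The term `(t ^ i / q_(i)) * I_a(r_(i), d_(i))`. -/
noncomputable def term {R : Type*} [CommRing R] [IsLocalRing R] (r : ℕ → ℕ) (d : ℕ → Rˣ)
    (t : ℂ) (i : ℕ) (a : R) : ℂ :=
  t ^ i / (cardTo (residueCard R) r i : ℂ) * tableI a (rankTo r i) (discTo d i : R) t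

end Table

end Igusa

/-! The proof iterates one decomposition of the domain of integration. Let U be the sum of the forms
with exponent 0, of total rank r and with matrix M; it is unimodular. Suppose π divides the
coefficient of L, and split R^n by the residues of the indeterminates of U.

On a class with nonzero residue z the gradient 2Mz is nonzero modulo π, as M and 2 are invertible
there. Either f is a unit on the class, which then contributes q^{-r}, or f is π times a function
with uniformly distributed values, and the class contributes q^{-r} t g. Hence only the number of
zeros of the reduction matters. The classical count of points on a quadric over a finite field turns
the sum over these classes into I_a(r, d) (`countDiag_even_and_odd`, `tableI_eq_of_count`,
`IsFormPlus.integral_eq`).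

On the zero class x = πy the form U gains a factor π². If c is a unit then |f| = 1 and the class
contributes q^{-r}. If π divides c, division by π leaves a polynomial of the same kind, in which
exponent 0 has become 1 and the others have dropped by 1 (`FormData.zeta_step`). After j steps the
forms with exponent 0 are those with i ≤ j and i ≡ j mod 2, whence r_(j) and d_(j), and the volumes
of the nested zero classes multiply to 1/q_(j) (`FormData.zeta_iterate`).

The iteration stops when the coefficient of L becomes a unit (the values of f are then uniformly
distributed and the integral is g) or when c does. If L = c = 0 it never stops, but from step ω - 1
on the polynomial recurs with period 2; the resulting linear equation for its zeta function produces
the factor (1 - t²/q^r)^{-1}. -/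

set_option linter.unusedSectionVars false

namespace Igusa

/-! ### Haar measure on R and R^n, and its behaviour on residue classes -/

section Measure

variable {R : Type*} [CommRing R] [IsDomain R] [IsDiscreteValuationRing R]

theorem residueCard_pos [Finite (IsLocalRing.ResidueField R)] : 0 < residueCard R :=
  Nat.card_pos

theorem one_lt_residueCard [Finite (IsLocalRing.ResidueField R)] : 1 < residueCard R :=
  Finite.one_lt_card

theorem card_quotient_span_pow {π : R} (hπ : Irreducible π) (k : ℕ) :
    Nat.card (R ⧸ Ideal.span {π ^ k}) = residueCard R ^ k := by
  have h := cardQuot_pow_of_prime (P := IsLocalRing.maximalIdeal R)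
    (IsDiscreteValuationRing.not_a_field R) (i := k)
  rw [hπ.maximalIdeal_eq, Ideal.span_singleton_pow, Submodule.cardQuot_apply,
    Submodule.cardQuot_apply, ← hπ.maximalIdeal_eq] at h
  exact h

theorem finite_quotient_span_pow [Finite (IsLocalRing.ResidueField R)] {π : R}
    (hπ : Irreducible π) (k : ℕ) : Finite (R ⧸ Ideal.span {π ^ k}) := by
  refine Nat.finite_of_card_ne_zero ?_
  rw [card_quotient_span_pow hπ]
  exact (pow_pos residueCard_pos k).ne'

variable [TopologicalSpace R] [IsTopologicalRing R] [CompactSpace R] [MeasurableSpace R]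
  [BorelSpace R]

variable (R) in
/-- The Haar measure on `R`, normalized to have total volume `1`. -/
noncomputable abbrev haarOne : Measure R :=
  Measure.addHaarMeasure (⊤ : TopologicalSpace.PositiveCompacts R)

instance : IsProbabilityMeasure (haarOne R) :=
  ⟨by simpa using Measure.addHaarMeasure_self (K₀ := (⊤ : TopologicalSpace.PositiveCompacts R))⟩

instance {σ : Type*} [Fintype σ] : IsProbabilityMeasure (haar R σ) := by
  unfold haar; infer_instance

variable [T2Space R] [Finite (IsLocalRing.ResidueField R)] {π : R}

theorem isClosed_dvd (a : R) : IsClosed {x : R | a ∣ x} := by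
  have := IsNoetherianRing.isClosed_ideal (Ideal.span {a})
  convert this using 1
  ext x
  simp [Ideal.mem_span_singleton]

theorem measurableSet_dvd_sub (a z : R) : MeasurableSet {x : R | a ∣ x - z} :=
  ((isClosed_dvd a).preimage (continuous_id.sub continuous_const)).measurableSet

theorem haarOne_dvd (hπ : Irreducible π) (k : ℕ) :
    haarOne R {x | π ^ k ∣ x} = ((residueCard R : ENNReal) ^ k)⁻¹ := by
  let H : AddSubgroup R := (Ideal.span {π ^ k}).toAddSubgroup
  have hH : (H : Set R) = {x | π ^ k ∣ x} := by
    ext x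
    simp [H, Ideal.mem_span_singleton]
  have hi : H.index = residueCard R ^ k := card_quotient_span_pow hπ k
  have : H.FiniteIndex := ⟨by rw [hi]; exact (pow_pos residueCard_pos k).ne'⟩
  have h := AddSubgroup.index_mul_measure H (hH ▸ (isClosed_dvd _).measurableSet) (haarOne R)
  rw [hH, hi, measure_univ, mul_comm] at h
  rw [ENNReal.eq_inv_of_mul_eq_one_left h]
  simp

theorem haarOne_dvd_sub (hπ : Irreducible π) (k : ℕ) (z : R) :
    haarOne R {x | π ^ k ∣ x - z} = ((residueCard R : ENNReal) ^ k)⁻¹ := by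
  rw [← haarOne_dvd hπ k, ← measure_preimage_add_right (haarOne R) (-z) {x | π ^ k ∣ x}]
  simp [sub_eq_add_neg]

/-- The pullback of Haar measure along the affine embedding is translation invariant, hence a
multiple of Haar measure by uniqueness. Its total mass is the measure of a residue class, which
fixes the scalar. -/
theorem restrict_haarOne (hπ : Irreducible π) (z : R) :
    (haarOne R).restrict {x | π ∣ x - z} =
      (residueCard R : ENNReal)⁻¹ • (haarOne R).map (fun y => z + π * y) := by
  have hinj : Function.Injective (fun y : R => z + π * y) := fun x y h => by
    simpa [hπ.ne_zero] using h
  have hcont : Continuous (fun y : R => z + π * y) := by fun_prop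
  have hemb : MeasurableEmbedding (fun y : R => z + π * y) :=
    (hcont.isClosedEmbedding hinj).measurableEmbedding
  have hrange : Set.range (fun y : R => z + π * y) = {x | π ∣ x - z} := by
    ext x
    simp only [Set.mem_range, Set.mem_ofPred_eq, dvd_iff_exists_eq_mul_right]
    exact exists_congr fun y => ⟨fun h => by rw [← h]; ring, fun h => by rw [← h]; ring⟩
  set ν := (haarOne R).comap (fun y : R => z + π * y) with hν
  have hνap (s : Set R) : ν s = haarOne R ((fun y : R => z + π * y) '' s) := hemb.comap_apply _ _
  have : ν.IsAddLeftInvariant := by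
    refine ⟨fun g => Measure.ext fun s hs => ?_⟩
    rw [Measure.map_apply (measurable_const_add g) hs, hνap, hνap,
      
      ← measure_preimage_add (haarOne R) (π * g) ((fun y : R => z + π * y) '' s)]
    congr 1
    ext x
    simp only [Set.mem_image, Set.mem_preimage]
    constructor
    · rintro ⟨y, hy, rfl⟩
      exact ⟨g + y, hy, by ring⟩
    · rintro ⟨y, hy, h⟩
      exact ⟨y - g, by simpa using hy, by linear_combination h⟩
  have hfin : IsFiniteMeasure ν := ⟨by rw [hνap]; exact measure_lt_top _ _⟩
  obtain ⟨a, ha⟩ : ∃ a : NNReal, ν = a • haarOne R :=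
    ⟨_, Measure.isAddInvariant_eq_smul_of_compactSpace ν (haarOne R)⟩
  have hc : (a : ENNReal) = (residueCard R : ENNReal)⁻¹ := by
    have h := hνap Set.univ
    rw [Set.image_univ, hrange, ha, Measure.smul_apply, measure_univ] at h
    have h1 := haarOne_dvd_sub hπ 1 z
    simp only [pow_one] at h1
    rw [h1] at h
    rw [← h, ENNReal.smul_def, smul_eq_mul, mul_one]
  rw [← hrange, ← hemb.map_comap, ← hν, ha, ← hc, Measure.map_smul]
  rfl

/-- The translate by `z` and dilation by `π` of the coordinates in `S`. -/
def dilate {σ : Type*} (π : R) (S : Set σ) [DecidablePred (· ∈ S)] (z : σ → R) (y : σ → R) :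
    σ → R :=
  fun i => if i ∈ S then z i + π * y i else y i

variable {σ : Type*} [Fintype σ]

theorem measurable_dilate (S : Set σ) [DecidablePred (· ∈ S)] (z : σ → R) :
    Measurable (dilate π S z) := by
  refine measurable_pi_lambda _ fun i => ?_
  by_cases h : i ∈ S
  · simp only [dilate, h, if_true]
    have hcont : Continuous (fun y : R => z i + π * y) := by fun_prop
    exact hcont.measurable.comp (measurable_pi_apply i)
  · simp only [dilate, h, if_false]
    exact measurable_pi_apply i

theorem measurableSet_dvd_on (S : Set σ) (z : σ → R) :
    MeasurableSet {x : σ → R | ∀ i ∈ S, π ∣ x i - z i} := by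
  have : {x : σ → R | ∀ i ∈ S, π ∣ x i - z i} =
      Set.pi S (fun i => {x : R | π ∣ x - z i}) := by
    ext x; simp [Set.mem_pi]
  rw [this]
  exact MeasurableSet.pi S.to_countable fun i _ => measurableSet_dvd_sub _ _

theorem restrict_haar (hπ : Irreducible π) (S : Set σ) [DecidablePred (· ∈ S)] (z : σ → R) :
    (haar R σ).restrict {x | ∀ i ∈ S, π ∣ x i - z i} =
      ((residueCard R : ENNReal) ^ S.ncard)⁻¹ • (haar R σ).map (dilate π S z) := by
  classical
  have hset : {x : σ → R | ∀ i ∈ S, π ∣ x i - z i} =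
      Set.pi Set.univ (fun i => if i ∈ S then {x : R | π ∣ x - z i} else Set.univ) := by
    ext x
    simp only [Set.mem_ofPred_eq, Set.mem_pi, Set.mem_univ, true_imp_iff]
    refine forall_congr' fun i => ?_
    split_ifs with h <;> simp [h]
  have hm (i : σ) : Measurable (fun y : R => if i ∈ S then z i + π * y else y) := by
    split_ifs
    · exact Continuous.measurable (by fun_prop)
    · exact measurable_id
  have : ∀ i, IsProbabilityMeasure
      ((haarOne R).map (fun y : R => if i ∈ S then z i + π * y else y)) :=
    fun i => Measure.isProbabilityMeasure_map (hm i).aemeasurable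
  have hmap : (haar R σ).map (dilate π S z) =
      Measure.pi fun i => (haarOne R).map (fun y : R => if i ∈ S then z i + π * y else y) :=
    Measure.pi_map_pi (fun i => (hm i).aemeasurable)
  rw [hset, haar, Measure.restrict_pi_pi, ← haar, hmap]
  refine (Measure.pi_eq fun s hs => ?_)
  rw [Measure.smul_apply, Measure.pi_pi]
  have hi (i : σ) : (haarOne R).restrict (if i ∈ S then {x : R | π ∣ x - z i} else Set.univ) (s i) =
      (if i ∈ S then (residueCard R : ENNReal)⁻¹ else 1) *
        (haarOne R).map (fun y : R => if i ∈ S then z i + π * y else y) (s i) := by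
    split_ifs
    · rw [restrict_haarOne hπ]; rfl
    · simp
  simp_rw [hi]
  rw [Finset.prod_mul_distrib, Finset.prod_ite]
  simp [Set.ncard_eq_toFinset_card', ENNReal.inv_pow]

theorem setIntegral_haar (hπ : Irreducible π) (S : Set σ) [DecidablePred (· ∈ S)] (z : σ → R)
    {G : (σ → R) → ℂ} (hG : Measurable G) :
    ∫ x in {x | ∀ i ∈ S, π ∣ x i - z i}, G x ∂(haar R σ) =
      ((residueCard R : ℂ) ^ S.ncard)⁻¹ * ∫ y, G (dilate π S z y) ∂(haar R σ) := by
  rw [restrict_haar hπ, integral_smul_measure, integral_map (measurable_dilate S z).aemeasurable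
    hG.aestronglyMeasurable]
  simp [Complex.real_smul]

end Measure

/-! ### The absolute value and integrals of its powers -/

section Valuation

variable {R : Type*} [CommRing R] [IsDomain R] [IsDiscreteValuationRing R] {π : R}

theorem le_val_iff (hπ : Irreducible π) (k : ℕ) (x : R) : (k : ℕ∞) ≤ val x ↔ π ^ k ∣ x := by
  rw [val, ← hπ.addVal_pow, IsDiscreteValuationRing.addVal_le_iff_dvd]

theorem val_eq_top_iff (x : R) : val x = ⊤ ↔ x = 0 :=
  IsDiscreteValuationRing.addVal_eq_top_iff

theorem val_eq_coe_iff (hπ : Irreducible π) (k : ℕ) (x : R) :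
    val x = k ↔ π ^ k ∣ x ∧ ¬ π ^ (k + 1) ∣ x := by
  rw [← le_val_iff hπ, ← le_val_iff hπ, not_le, Nat.cast_add, Nat.cast_one,
    ENat.lt_add_one_iff (by simp), le_antisymm_iff, and_comm]

theorem absVal_pi_mul (hπ : Irreducible π) (x : R) :
    absVal (π * x) = (residueCard R : ℝ)⁻¹ * absVal x := by
  by_cases hx : x = 0
  · simp [absVal, hx]
  · obtain ⟨n, hn⟩ := ENat.ne_top_iff_exists.mp ((val_eq_top_iff x).not.mpr hx)
    have hm : val (π * x) = ((n + 1 : ℕ) : ℕ∞) := by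
      rw [val, IsDiscreteValuationRing.addVal_mul, IsDiscreteValuationRing.addVal_uniformizer hπ,
        ← val, ← hn, add_comm]
      rfl
    rw [absVal, absVal, if_neg (mul_ne_zero hπ.ne_zero hx), if_neg hx, hm, ← hn]
    simp only [ENat.toNat_natCast]
    rw [pow_succ', mul_inv]

theorem absVal_of_isUnit {x : R} (hx : IsUnit x) : absVal x = 1 := by
  have h0 : val x = 0 := by
    obtain ⟨u, rfl⟩ := hx
    exact IsDiscreteValuationRing.addVal_eq_zero_of_unit u
  rw [absVal, if_neg hx.ne_zero, h0]
  simp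

theorem absVal_nonneg (x : R) : 0 ≤ absVal x := by
  unfold absVal
  split_ifs <;> positivity

theorem absVal_le_one [Finite (IsLocalRing.ResidueField R)] (x : R) : absVal x ≤ 1 := by
  unfold absVal
  split_ifs
  · exact zero_le_one
  · exact inv_le_one_of_one_le₀ (one_le_pow₀ (by exact_mod_cast one_lt_residueCard.le))

theorem absVal_pi_mul_cpow (hπ : Irreducible π) (x : R) (s : ℂ) :
    (absVal (π * x) : ℂ) ^ s = (residueCard R : ℂ) ^ (-s) * (absVal x : ℂ) ^ s := by
  rw [absVal_pi_mul hπ, Complex.ofReal_mul,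
    Complex.mul_cpow_ofReal_nonneg (by positivity) (absVal_nonneg x), Complex.ofReal_inv,
    Complex.ofReal_natCast, Complex.cpow_neg, Complex.inv_cpow]
  rw [Complex.natCast_arg]
  exact Real.pi_ne_zero.symm

theorem absVal_cpow_of_isUnit {x : R} (hx : IsUnit x) (s : ℂ) : (absVal x : ℂ) ^ s = 1 := by
  rw [absVal_of_isUnit hx]; simp

/-- Makes the integrand a function of `val`, which has countably many values. The case of a zero
value needs `s ≠ 0`, since `0 ^ 0 = 1`. -/
theorem absVal_cpow_eq (hπ : Irreducible π) {s : ℂ} (hs : s ≠ 0) (x : R) :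
    (absVal x : ℂ) ^ s = if val x = ⊤ then 0 else ((residueCard R : ℂ) ^ (-s)) ^ (val x).toNat := by
  split_ifs with h
  · rw [(val_eq_top_iff x).mp h]
    simp [absVal, hs]
  · obtain ⟨n, hn⟩ := ENat.ne_top_iff_exists.mp h
    rw [← hn, ENat.toNat_natCast]
    clear h
    induction n generalizing x with
    | zero =>
      have : IsUnit x := IsDiscreteValuationRing.addVal_eq_zero_iff.mp hn.symm
      simpa using absVal_cpow_of_isUnit this s
    | succ n ih =>
      obtain ⟨y, rfl⟩ : π ∣ x :=
        (dvd_pow_self π n.succ_ne_zero).trans (((val_eq_coe_iff hπ _ x).mp hn.symm).1)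
      rw [absVal_pi_mul_cpow hπ, ih y, pow_succ']
      rw [val, IsDiscreteValuationRing.addVal_mul, IsDiscreteValuationRing.addVal_uniformizer hπ,
        add_comm n, Nat.cast_add, Nat.cast_one, add_comm, add_comm 1] at hn
      exact ENat.add_left_injective_of_ne_top ENat.one_ne_top hn

theorem norm_card_cpow_lt_one [Finite (IsLocalRing.ResidueField R)] {s : ℂ} (hs : 0 < s.re) :
    ‖(residueCard R : ℂ) ^ (-s)‖ < 1 := by
  rw [Complex.norm_natCast_cpow_of_pos residueCard_pos]
  exact Real.rpow_lt_one_of_one_lt_of_neg (by exact_mod_cast one_lt_residueCard) (by simpa using hs)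

theorem one_sub_div_ne_zero [Finite (IsLocalRing.ResidueField R)] {t : ℂ} (ht : ‖t‖ < 1) :
    1 - t / (residueCard R : ℂ) ≠ 0 := by
  intro h
  have hq : (1 : ℝ) < residueCard R := by exact_mod_cast one_lt_residueCard
  have h1 : ‖t / (residueCard R : ℂ)‖ = 1 := by rw [← sub_eq_zero.mp h]; simp
  rw [norm_div, Complex.norm_natCast, div_eq_one_iff_eq (by positivity)] at h1
  linarith

section Integral

variable {X : Type*} [MeasurableSpace X] {h : X → R}

/-- Only the divisibility sets are assumed measurable, not `h` itself: this is what passes to a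
quotient of `f` by `π` obtained by choice. -/
theorem measurable_val_comp (hπ : Irreducible π) (hh : ∀ k, MeasurableSet {x | π ^ k ∣ h x}) :
    Measurable (fun x => val (h x)) := by
  refine measurable_to_countable' fun n => ?_
  induction n using ENat.recTopCoe with
  | top =>
    have : (fun x => val (h x)) ⁻¹' {⊤} = ⋂ k, {x | π ^ k ∣ h x} := by
      ext x
      simp only [Set.mem_preimage, Set.mem_singleton_iff, Set.mem_iInter, Set.mem_ofPred_eq,
        ← le_val_iff hπ]
      exact ⟨fun h k => h ▸ le_top, fun h => ENat.eq_top_iff_forall_ge.mpr h⟩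
    rw [this]
    exact MeasurableSet.iInter hh
  | coe k =>
    have : (fun x => val (h x)) ⁻¹' {(k : ℕ∞)} = {x | π ^ k ∣ h x} \ {x | π ^ (k + 1) ∣ h x} := by
      ext x
      simp [val_eq_coe_iff hπ]
    rw [this]
    exact (hh _).diff (hh _)

theorem measurable_absVal_cpow (hπ : Irreducible π)
    (hh : ∀ k, MeasurableSet {x | π ^ k ∣ h x}) {s : ℂ} (hs : s ≠ 0) :
    Measurable (fun x => (absVal (h x) : ℂ) ^ s) := by
  simp_rw [absVal_cpow_eq hπ hs]
  exact (measurable_of_countable (fun n : ℕ∞ => if n = ⊤ then (0 : ℂ) else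
    ((residueCard R : ℂ) ^ (-s)) ^ n.toNat)).comp (measurable_val_comp hπ hh)

variable [Finite (IsLocalRing.ResidueField R)] {μ : Measure X} [IsProbabilityMeasure μ]

theorem norm_absVal_cpow_le {s : ℂ} (hs : 0 < s.re) (x : R) : ‖(absVal x : ℂ) ^ s‖ ≤ 1 := by
  have hs0 : s.re ≠ 0 := hs.ne'
  rw [Complex.norm_cpow_eq_rpow_re_of_nonneg (absVal_nonneg x) hs0]
  exact Real.rpow_le_one (absVal_nonneg x) (absVal_le_one x) hs.le

theorem integrable_absVal_cpow (hπ : Irreducible π)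
    (hh : ∀ k, MeasurableSet {x | π ^ k ∣ h x}) {s : ℂ} (hs : 0 < s.re) :
    Integrable (fun x => (absVal (h x) : ℂ) ^ s) μ :=
  Integrable.of_bound
    (measurable_absVal_cpow hπ hh (by rintro rfl; simp at hs)).aestronglyMeasurable 1 (Filter.Eventually.of_forall fun x => norm_absVal_cpow_le hs _)

/-- The set of valuation k has measure q^{-k} - q^{-k-1}, so the integral is the geometric series ∑
(1 - 1/q)(t/q)^k. -/
theorem integral_absVal_cpow_of_uniform (hπ : Irreducible π)
    (hh : ∀ k, MeasurableSet {x | π ^ k ∣ h x})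
    (hμ : ∀ k, μ {x | π ^ k ∣ h x} = ((residueCard R : ENNReal) ^ k)⁻¹) {s : ℂ} (hs : 0 < s.re) :
    ∫ x, (absVal (h x) : ℂ) ^ s ∂μ = geom (residueCard R) ((residueCard R : ℂ) ^ (-s)) := by
  have hs0 : s ≠ 0 := by rintro rfl; simp at hs
  have hv := measurable_val_comp hπ hh
  set t := (residueCard R : ℂ) ^ (-s) with ht
  have ht1 : ‖t‖ < 1 := norm_card_cpow_lt_one hs
  have hq : (1 : ℝ) < residueCard R := by exact_mod_cast one_lt_residueCard
  have hqc : (residueCard R : ℂ) ≠ 0 := by exact_mod_cast (residueCard_pos (R := R)).ne'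
  set G : ℕ∞ → ℂ := fun n => if n = ⊤ then (0 : ℂ) else t ^ n.toNat with hG
  have hGb (n : ℕ∞) : ‖G n‖ ≤ 1 := by
    simp only [hG]
    split_ifs
    · simp
    · rw [norm_pow]; exact pow_le_one₀ (norm_nonneg _) ht1.le
  have hprob : IsProbabilityMeasure (μ.map fun x => val (h x)) :=
    Measure.isProbabilityMeasure_map hv.aemeasurable
  have h1 : ∫ x, (absVal (h x) : ℂ) ^ s ∂μ = ∫ n, G n ∂(μ.map fun x => val (h x)) := by
    rw [integral_map hv.aemeasurable (measurable_of_countable G).aestronglyMeasurable]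
    simp_rw [absVal_cpow_eq hπ hs0, hG, ht]
  rw [h1, integral_countable (Integrable.of_bound
    (measurable_of_countable G).aestronglyMeasurable 1 (Filter.Eventually.of_forall hGb))]
  have hinj : Function.Injective ((↑) : ℕ → ℕ∞) := Nat.cast_injective
  -- `G` vanishes at `⊤`, so the sum over `ℕ∞` is a sum over `ℕ`.
  rw [← hinj.tsum_eq]
  · have hterm (k : ℕ) : (μ.map fun x => val (h x)).real {(k : ℕ∞)} • G k =
        (1 - 1 / (residueCard R : ℂ)) * (t / residueCard R) ^ k := by
      have hset : (fun x => val (h x)) ⁻¹' {(k : ℕ∞)} =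
          {x | π ^ k ∣ h x} \ {x | π ^ (k + 1) ∣ h x} := by
        ext x
        simp [val_eq_coe_iff hπ]
      rw [map_measureReal_apply hv (measurableSet_singleton _), hset,
        measureReal_sdiff (s₁ := {x | π ^ k ∣ h x}) (s₂ := {x | π ^ (k + 1) ∣ h x})
          (fun x hx => (pow_dvd_pow π k.le_succ).trans hx) (hh _), measureReal_def,
        measureReal_def, hμ, hμ]
      simp only [hG, ENat.natCast_ne_top, if_false, ENat.toNat_natCast, ENNReal.toReal_inv,
        ENNReal.toReal_pow, ENNReal.toReal_natCast, Complex.real_smul, Complex.ofReal_sub,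
        Complex.ofReal_inv, Complex.ofReal_pow, Complex.ofReal_natCast]
      rw [div_pow, pow_succ]
      field_simp
    simp_rw [hterm]
    rw [tsum_mul_left, tsum_geometric_of_norm_lt_one, geom, ← div_eq_mul_inv]
    rw [norm_div, Complex.norm_natCast, div_lt_one (by linarith)]
    linarith
  · intro n hn
    rw [Function.mem_support] at hn
    obtain ⟨k, hk⟩ := ENat.ne_top_iff_exists.mp (show n ≠ ⊤ by rintro rfl; simp [hG] at hn)
    exact ⟨k, hk⟩

end Integral

end Valuation

/-! ### Uniform distribution of values, and measurability for polynomials -/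

section Uniform

variable {R : Type*} [CommRing R] [IsDomain R] [IsDiscreteValuationRing R]
  [Finite (IsLocalRing.ResidueField R)] {π : R}

/-- A map which multiplies differences by units is bijective modulo `π ^ k`. -/
theorem exists_dvd_iff_dvd_sub (hπ : Irreducible π) {φ : R → R}
    (hφ : ∀ v w, ∃ u : Rˣ, φ v - φ w = u * (v - w)) (k : ℕ) :
    ∃ w, ∀ v, π ^ k ∣ φ v ↔ π ^ k ∣ v - w := by
  have := finite_quotient_span_pow hπ k
  have hiff (v w : R) : π ^ k ∣ φ v - φ w ↔ π ^ k ∣ v - w := by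
    obtain ⟨u, hu⟩ := hφ v w
    rw [hu, Units.dvd_mul_left]
  let f : R ⧸ Ideal.span {π ^ k} → R ⧸ Ideal.span {π ^ k} :=
    fun x => Ideal.Quotient.mk _ (φ (Quotient.out x))
  have hf : Function.Injective f := fun x y hxy => by
    have h := (Ideal.Quotient.eq.mp hxy)
    rw [Ideal.mem_span_singleton, hiff, ← Ideal.mem_span_singleton, ← Ideal.Quotient.eq] at h
    simpa using h
  -- An injective self-map of the finite quotient is onto; the class of `w` is a preimage of 0.
  obtain ⟨x, hx⟩ := Finite.surjective_of_injective hf 0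
  refine ⟨Quotient.out x, fun v => ?_⟩
  rw [Ideal.Quotient.eq_zero_iff_mem, Ideal.mem_span_singleton] at hx
  rw [← hiff, dvd_sub_left hx]

variable [TopologicalSpace R] [IsTopologicalRing R] [CompactSpace R] [MeasurableSpace R]
  [BorelSpace R] [T2Space R] {σ : Type*} [Fintype σ]

open Classical in
-- Fubini in the coordinate `i`: with the others fixed, the condition cuts out a single coset of
-- (π^k), by `exists_dvd_iff_dvd_sub`.
theorem haar_dvd_of_update (hπ : Irreducible π) {h : (σ → R) → R}
    (hh : ∀ k, MeasurableSet {x | π ^ k ∣ h x}) (i : σ)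
    (hi : ∀ x v w, ∃ u : Rˣ,
      h (Function.update x i v) - h (Function.update x i w) = u * (v - w)) (k : ℕ) :
    haar R σ {x | π ^ k ∣ h x} = ((residueCard R : ENNReal) ^ k)⁻¹ := by
  have : ∫⁻ x, Set.indicator {x | π ^ k ∣ h x} 1 x ∂(haar R σ) =
      ∫⁻ x, (fun _ => ((residueCard R : ENNReal) ^ k)⁻¹) x ∂(haar R σ) := by
    refine lintegral_eq_of_lmarginal_eq {i} (measurable_one.indicator (hh k)) measurable_const ?_
    rw [lmarginal_singleton, lmarginal_singleton]
    funext x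
    obtain ⟨w, hw⟩ := exists_dvd_iff_dvd_sub hπ (hi x) k
    have h1 : (fun v => Set.indicator {x | π ^ k ∣ h x} (1 : (σ → R) → ENNReal)
        (Function.update x i v)) = Set.indicator {v | π ^ k ∣ v - w} 1 := by
      funext v
      simp only [Set.indicator, Set.mem_ofPred_eq, Pi.one_apply]
      simp only [hw v]
    rw [h1, lintegral_indicator_one (measurableSet_dvd_sub _ _), haarOne_dvd_sub hπ]
    simp
  rw [lintegral_indicator_one (hh k)] at this
  simpa using this

/-- Divisibility by π^k depends only on the coordinates modulo π^k, which range over a finite set.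
-/
theorem measurableSet_dvd_eval (hπ : Irreducible π) (f : MvPolynomial σ R) (k : ℕ) :
    MeasurableSet {x | π ^ k ∣ eval x f} := by
  have := finite_quotient_span_pow hπ k
  let I := Ideal.span {π ^ k}
  let _ : MeasurableSpace (R ⧸ I) := ⊤
  have hmk : Measurable (Ideal.Quotient.mk I) := by
    refine measurable_to_countable' fun y => ?_
    obtain ⟨z, rfl⟩ := Ideal.Quotient.mk_surjective y
    convert! measurableSet_dvd_sub (π ^ k) z using 1
    ext x
    simp [Ideal.Quotient.eq, I, Ideal.mem_span_singleton]
  have hm : Measurable (fun (x : σ → R) i => Ideal.Quotient.mk I (x i)) :=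
    measurable_pi_lambda _ fun i => hmk.comp (measurable_pi_apply i)
  convert! hm (Set.toFinite {y | eval₂ (Ideal.Quotient.mk I) y f = 0}).measurableSet using 1
  ext x
  have h : eval₂ (Ideal.Quotient.mk I) (fun i => Ideal.Quotient.mk I (x i)) f =
      Ideal.Quotient.mk I (eval x f) := by
    rw [eval, coe_eval₂Hom, eval₂_comp_left]
    rfl
  simp only [Set.mem_preimage, Set.mem_ofPred_eq, h, Ideal.Quotient.eq_zero_iff_mem, I,
    Ideal.mem_span_singleton]

end Uniform

/-! ### Counting points on quadrics over a finite field of odd characteristic -/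

section FiniteField

variable {F : Type*} [Field F] [Fintype F] [DecidableEq F]

theorem sum_ite_mul_sq_eq (hF : ringChar F ≠ 2) {w : F} (hw : w ≠ 0) (a : F) :
    ∑ x : F, (if w * x ^ 2 = a then (1 : ℤ) else 0) = 1 + quadraticChar F (a * w) := by
  have h := quadraticChar_card_sqrts hF (a * w)
  rw [add_comm, ← h, Finset.sum_boole]
  simp only [Set.toFinset_ofPred]
  refine congrArg _ (Finset.card_bij (fun x _ => w * x) ?_ ?_ ?_)
  · intro x hx
    simp only [Finset.mem_filter, Finset.mem_univ, true_and] at hx ⊢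
    rw [← hx]; ring
  · intro x _ y _ hxy
    exact mul_left_cancel₀ hw hxy
  · intro y hy
    simp only [Finset.mem_filter, Finset.mem_univ, true_and] at hy ⊢
    refine ⟨y / w, ?_, by field_simp⟩
    field_simp
    linear_combination hy

theorem sum_ite_mul_eq (c : F) :
    ∑ x : F × F, (if x.1 * x.2 = c then (1 : ℤ) else 0) =
      Fintype.card F - 1 + if c = 0 then (Fintype.card F : ℤ) else 0 := by
  rw [Fintype.sum_prod_type, ← Finset.add_sum_erase _ _ (Finset.mem_univ (0 : F)), add_comm]
  congr 1
  · rw [Finset.sum_congr rfl (g := fun _ => (1 : ℤ))]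
    · rw [Finset.sum_const, Finset.card_erase_of_mem (Finset.mem_univ _), Finset.card_univ,
        nsmul_eq_mul, mul_one, Nat.cast_sub Fintype.card_pos, Nat.cast_one]
    · intro x hx
      have hx0 : x ≠ 0 := Finset.ne_of_mem_erase hx
      have h (y : F) : x * y = c ↔ y = c / x := by rw [eq_div_iff hx0, mul_comm]
      simp [h]
  · by_cases hc : c = 0
    · simp [hc]
    · simp [hc, Ne.symm hc]

/-- Since 1 + χ(x² - c) counts the y with y² = x² - c, the sum counts points of (x - y)(x + y) = c,
which is the hyperbola uv = c because 2 is invertible. -/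
theorem sum_quadraticChar_sq_sub (hF : ringChar F ≠ 2) (c : F) :
    ∑ x : F, quadraticChar F (x ^ 2 - c) = (if c = 0 then (Fintype.card F : ℤ) else 0) - 1 := by
  have h2 : (2 : F) ≠ 0 := Ring.two_ne_zero hF
  have h (x : F) : quadraticChar F (x ^ 2 - c) =
      ∑ y : F, (if (x - y) * (x + y) = c then (1 : ℤ) else 0) - 1 := by
    have h1 := sum_ite_mul_sq_eq hF one_ne_zero (x ^ 2 - c)
    rw [mul_one] at h1
    rw [eq_sub_iff_add_eq, add_comm, ← h1]
    refine Finset.sum_congr rfl fun y _ => if_congr ?_ rfl rfl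
    constructor <;> intro h <;> linear_combination -h
  let e : F × F ≃ F × F :=
    { toFun := fun x => (x.1 - x.2, x.1 + x.2)
      invFun := fun x => ((x.1 + x.2) / 2, (x.2 - x.1) / 2)
      left_inv := fun x => by ext <;> simp <;> field_simp <;> ring
      right_inv := fun x => by ext <;> simp <;> field_simp <;> ring }
  simp_rw [h]
  have he := Fintype.sum_equiv e
    (fun x : F × F => if (x.1 - x.2) * (x.1 + x.2) = c then (1 : ℤ) else 0)
    (fun x => if x.1 * x.2 = c then (1 : ℤ) else 0) (fun x => rfl)
  rw [sum_ite_mul_eq, Fintype.sum_prod_type] at he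
  rw [Finset.sum_sub_distrib, he]
  simp only [Finset.sum_const, Finset.card_univ, nsmul_eq_mul, mul_one]
  ring

theorem sum_quadraticChar_sub_mul_sq (hF : ringChar F ≠ 2) {w : F} (hw : w ≠ 0) (a : F) :
    ∑ x : F, quadraticChar F (a - w * x ^ 2) =
      quadraticChar F (-w) * ((if a = 0 then (Fintype.card F : ℤ) else 0) - 1) := by
  have h := sum_quadraticChar_sq_sub hF (a / w)
  simp only [div_eq_zero_iff, hw, or_false] at h
  rw [← h, Finset.mul_sum]
  refine Finset.sum_congr rfl fun x _ => ?_
  rw [← map_mul]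
  congr 1
  field_simp
  ring

/-- The number of solutions of `∑ i, w i * x i ^ 2 = a`. -/
def countDiag {n : ℕ} (w : Fin n → F) (a : F) : ℤ :=
  ∑ x : Fin n → F, if ∑ i, w i * x i ^ 2 = a then 1 else 0

theorem countDiag_succ {n : ℕ} (w : Fin (n + 1) → F) (a : F) :
    countDiag w a = ∑ x : F, countDiag (Fin.tail w) (a - w 0 * x ^ 2) := by
  unfold countDiag
  rw [← Fintype.sum_equiv (Fin.consEquiv (fun _ => F)) (fun x : F × (Fin n → F) =>
    if ∑ i, Fin.tail w i * x.2 i ^ 2 = a - w 0 * x.1 ^ 2 then (1 : ℤ) else 0),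
    Fintype.sum_prod_type]
  intro x
  refine if_congr ?_ rfl rfl
  simp only [Fin.sum_univ_succ, Fin.consEquiv, Equiv.coe_fn_mk, Fin.cons_zero, Fin.cons_succ,
    Fin.tail]
  constructor <;> intro h <;> linear_combination h

/-- Induction peeling off one variable. From even to odd, the term supported at a = 0 sums to a
count of solutions of w₀x² = a; from odd to even, χ(a - w₀x²) is summed. The even count is
multiplied by q to avoid the exponent m - 1 when m = 0. -/
theorem countDiag_even_and_odd (hF : ringChar F ≠ 2) (m : ℕ) :
    (∀ (w : Fin (2 * m) → F), (∀ i, w i ≠ 0) → ∀ a,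
      Fintype.card F * countDiag w a = (Fintype.card F : ℤ) ^ (2 * m) +
        quadraticChar F ((-1) ^ m * ∏ i, w i) * Fintype.card F ^ m *
          ((if a = 0 then (Fintype.card F : ℤ) else 0) - 1)) ∧
    (∀ (w : Fin (2 * m + 1) → F), (∀ i, w i ≠ 0) → ∀ a,
      countDiag w a = (Fintype.card F : ℤ) ^ (2 * m) +
        quadraticChar F ((-1) ^ m * (∏ i, w i) * a) * Fintype.card F ^ m) := by
  have hq : (Fintype.card F : ℤ) ≠ 0 := by exact_mod_cast Fintype.card_ne_zero
  have odd_of_even (m : ℕ) (h : ∀ (w : Fin (2 * m) → F), (∀ i, w i ≠ 0) → ∀ a,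
      Fintype.card F * countDiag w a = (Fintype.card F : ℤ) ^ (2 * m) +
        quadraticChar F ((-1) ^ m * ∏ i, w i) * Fintype.card F ^ m *
          ((if a = 0 then (Fintype.card F : ℤ) else 0) - 1)) :
      ∀ (w : Fin (2 * m + 1) → F), (∀ i, w i ≠ 0) → ∀ a,
      countDiag w a = (Fintype.card F : ℤ) ^ (2 * m) +
        quadraticChar F ((-1) ^ m * (∏ i, w i) * a) * Fintype.card F ^ m := by
    intro w hw a
    refine mul_left_cancel₀ hq ?_
    have hs := sum_ite_mul_sq_eq hF (hw 0) a
    have hi (x : F) : (if a - w 0 * x ^ 2 = 0 then (Fintype.card F : ℤ) else 0) =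
        Fintype.card F * if w 0 * x ^ 2 = a then (1 : ℤ) else 0 := by
      rw [mul_ite, mul_one, mul_zero]
      exact if_congr (sub_eq_zero.trans eq_comm) rfl rfl
    rw [countDiag_succ, Finset.mul_sum, Finset.sum_congr rfl fun x _ =>
      h (Fin.tail w) (fun i => hw i.succ) (a - w 0 * x ^ 2)]
    simp_rw [hi]
    rw [Finset.sum_add_distrib, ← Finset.mul_sum, Finset.sum_sub_distrib, ← Finset.mul_sum, hs,
      Fin.prod_univ_succ]
    have hmul : quadraticChar F ((-1) ^ m * (w 0 * ∏ i : Fin (2 * m), w i.succ) * a) =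
        quadraticChar F ((-1) ^ m * ∏ i, Fin.tail w i) * quadraticChar F (a * w 0) := by
      rw [← map_mul]
      congr 1
      simp only [Fin.tail]
      ring
    rw [hmul]
    simp only [Finset.sum_const, Finset.card_univ, nsmul_eq_mul, mul_one]
    ring
  induction m with
  | zero =>
    have h0 : ∀ (w : Fin (2 * 0) → F), (∀ i, w i ≠ 0) → ∀ a,
      Fintype.card F * countDiag w a = (Fintype.card F : ℤ) ^ (2 * 0) +
        quadraticChar F ((-1) ^ 0 * ∏ i, w i) * Fintype.card F ^ 0 *
          ((if a = 0 then (Fintype.card F : ℤ) else 0) - 1) := by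
      intro w _ a
      have : IsEmpty (Fin (2 * 0)) := Fin.isEmpty
      simp [countDiag, eq_comm]
    exact ⟨h0, odd_of_even 0 h0⟩
  | succ m ih =>
    have h1 : ∀ (w : Fin (2 * (m + 1)) → F), (∀ i, w i ≠ 0) → ∀ a,
      Fintype.card F * countDiag w a = (Fintype.card F : ℤ) ^ (2 * (m + 1)) +
        quadraticChar F ((-1) ^ (m + 1) * ∏ i, w i) * Fintype.card F ^ (m + 1) *
          ((if a = 0 then (Fintype.card F : ℤ) else 0) - 1) := by
      intro w hw a
      change Fin (2 * m + 1 + 1) → F at w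
      change ∀ i : Fin (2 * m + 1 + 1), w i ≠ 0 at hw
      change Fintype.card F * countDiag (n := 2 * m + 1 + 1) w a =
        (Fintype.card F : ℤ) ^ (2 * (m + 1)) +
        quadraticChar F ((-1) ^ (m + 1) * ∏ i : Fin (2 * m + 1 + 1), w i) *
          Fintype.card F ^ (m + 1) *
          ((if a = 0 then (Fintype.card F : ℤ) else 0) - 1)
      have hmul (x : F) : quadraticChar F
          ((-1) ^ m * (∏ i, Fin.tail w i) * (a - w 0 * x ^ 2)) =
          quadraticChar F ((-1) ^ m * ∏ i, Fin.tail w i) * quadraticChar F (a - w 0 * x ^ 2) :=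
        map_mul _ _ _
      rw [countDiag_succ, Finset.sum_congr rfl fun x _ =>
        ih.2 (Fin.tail w) (fun i => hw i.succ) (a - w 0 * x ^ 2)]
      simp_rw [hmul]
      rw [Finset.sum_add_distrib, ← Finset.sum_mul, ← Finset.mul_sum,
        sum_quadraticChar_sub_mul_sq hF (hw 0)]
      have hmul' : quadraticChar F ((-1) ^ (m + 1) * (w 0 * ∏ i : Fin (2 * m + 1), w i.succ)) =
          quadraticChar F ((-1) ^ m * ∏ i, Fin.tail w i) * quadraticChar F (-w 0) := by
        rw [← map_mul]
        congr 1
        simp only [Fin.tail]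
        ring
      rw [Fin.prod_univ_succ (n := 2 * m + 1) w, hmul']
      simp only [Finset.sum_const, Finset.card_univ, nsmul_eq_mul]
      ring
    exact ⟨h1, odd_of_even (m + 1) h1⟩

open Matrix in
theorem exists_congruent_diagonal {ι : Type*} [Fintype ι] [DecidableEq ι] (hF : ringChar F ≠ 2)
    {M : Matrix ι ι F} (hM : M.IsSymm) :
    ∃ (P : Matrix ι ι F) (w : ι → F), IsUnit P.det ∧ Pᵀ * M * P = diagonal w := by
  have : Invertible (2 : F) := invertibleOfNonzero (Ring.two_ne_zero hF)
  have hB : LinearMap.IsSymm (Matrix.toBilin' M) := by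
    refine ⟨fun x y => ?_⟩
    rw [toBilin'_apply', toBilin'_apply', RingHom.id_apply, dotProduct_comm, ← vecMul_transpose,
      hM.eq, dotProduct_mulVec]
  obtain ⟨v, hv⟩ := LinearMap.BilinForm.exists_orthogonal_basis hB
  let e : Fin (Module.finrank F (ι → F)) ≃ ι := Fintype.equivOfCardEq (by simp)
  let P : Matrix ι ι F := (Pi.basisFun F ι).toMatrix (v.reindex e)
  refine ⟨P, fun i => (Pᵀ * M * P) i i, ?_, ?_⟩
  · have := (Pi.basisFun F ι).invertibleToMatrix (v.reindex e)
    exact isUnit_det_of_invertible P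
  · have hP (i j : ι) : (Pᵀ * M * P) i j = Matrix.toBilin' M (v (e.symm i)) (v (e.symm j)) := by
      rw [toBilin'_apply', Matrix.mul_assoc, mul_apply_eq_vecMul]
      simp only [P, Module.Basis.toMatrix, dotProduct, mul_apply, mulVec, vecMul, transpose_apply]
      simp
    ext i j
    by_cases hij : i = j
    · subst hij; simp
    · rw [diagonal_apply_ne _ hij, hP]
      exact hv (fun h => hij (e.symm.injective h))

/-- The number of solutions of `x M xᵀ = a`. -/
def countForm {ι : Type*} [Fintype ι] [DecidableEq ι] (M : Matrix ι ι F) (a : F) : ℤ :=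
  ∑ x : ι → F, if ∑ i, ∑ j, M i j * x i * x j = a then 1 else 0

open Matrix in
-- The substitution x = Py diagonalizes the form and changes its determinant by a square only, which
-- the quadratic character ignores.
theorem exists_countForm_eq_countDiag {ι : Type*} [Fintype ι] [DecidableEq ι]
    (hF : ringChar F ≠ 2) {M : Matrix ι ι F} (hM : M.IsSymm) {n : ℕ} (hn : Fintype.card ι = n) :
    ∃ (w : Fin n → F) (u : F), u ≠ 0 ∧ ∏ i, w i = M.det * u ^ 2 ∧
      ∀ a, countForm M a = countDiag w a := by
  obtain ⟨P, w, hP, hw⟩ := exists_congruent_diagonal hF hM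
  let e : Fin n ≃ ι := Fintype.equivOfCardEq (by simp [hn])
  refine ⟨fun i => w (e i), P.det, hP.ne_zero, ?_, fun a => ?_⟩
  · rw [Equiv.prod_comp e w, ← det_diagonal, ← hw, det_mul, det_mul, det_transpose]
    ring
  · have hinv : Invertible P := P.invertibleOfIsUnitDet hP
    let f : (Fin n → F) ≃ (ι → F) :=
      { toFun := fun y => P *ᵥ (fun i => y (e.symm i))
        invFun := fun x i => (P⁻¹ *ᵥ x) (e i)
        left_inv := fun y => by
          ext i
          simp [mulVec_mulVec]
        right_inv := fun x => by
          simp [mulVec_mulVec] }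
    unfold countForm countDiag
    refine (Fintype.sum_equiv f _
      (fun x => if ∑ i, ∑ j, M i j * x i * x j = a then (1 : ℤ) else 0)
      fun y => if_congr ?_ rfl rfl).symm
    have hq : ∑ i, ∑ j, M i j * f y i * f y j = f y ⬝ᵥ M *ᵥ f y := by
      simp only [dotProduct, mulVec, Finset.mul_sum]
      exact Finset.sum_congr rfl fun i _ => Finset.sum_congr rfl fun j _ => by ring
    have hd : f y ⬝ᵥ M *ᵥ f y =
        (fun i => y (e.symm i)) ⬝ᵥ (Pᵀ * M * P) *ᵥ (fun i => y (e.symm i)) := by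
      simp only [f, Equiv.coe_fn_mk]
      rw [dotProduct_mulVec, vecMul_mulVec, dotProduct_mulVec, vecMul_vecMul, dotProduct_mulVec]
    rw [hq, hd, hw, ← Equiv.sum_comp e.symm]
    simp only [dotProduct, mulVec_diagonal, Equiv.apply_symm_apply]
    have : ∀ i, w i * y (e.symm i) ^ 2 = y (e.symm i) * (w i * y (e.symm i)) := fun i => by ring
    simp_rw [this]

end FiniteField

/-! ### The table I_a(r, d) in terms of point counts -/

section Table

open IsLocalRing

variable {R : Type*} [CommRing R] [IsDomain R] [HenselianLocalRing R]
  [Fintype (ResidueField R)] [DecidableEq (ResidueField R)]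

theorem ringChar_residueField_ne_two (h2 : IsUnit (2 : R)) : ringChar (ResidueField R) ≠ 2 := by
  intro h
  have : (2 : ResidueField R) = 0 := by
    have := ringChar.Nat.cast_ringChar (R := ResidueField R)
    rw [h] at this
    exact_mod_cast this
  have h' : residue R 2 = 0 := by rw [map_ofNat]; exact this
  exact (residue_ne_zero_iff_isUnit 2).mpr h2 h'

/-- Hensel's lemma enters here: a square root a₀ of a unit b modulo π lifts, because the derivative
2a₀ of X² - b is a unit. -/
theorem eta_eq_quadraticChar (h2 : IsUnit (2 : R)) (b : R) :
    eta b = quadraticChar (ResidueField R) (residue R b) := by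
  have hF := ringChar_residueField_ne_two h2
  unfold eta
  split_ifs with hb hsq
  · obtain ⟨u, rfl⟩ := hsq
    rw [map_pow, quadraticChar_sq_one' ((residue_ne_zero_iff_isUnit _).mpr u.isUnit)]
  · have hb0 := (residue_ne_zero_iff_isUnit b).mpr hb
    symm
    rw [quadraticChar_neg_one_iff_not_isSquare]
    rintro ⟨y, hy⟩
    obtain ⟨a₀, rfl⟩ := residue_surjective y
    have ha₀ : IsUnit a₀ := by
      rw [← residue_ne_zero_iff_isUnit]
      intro h0
      rw [h0, mul_zero] at hy
      exact hb0 hy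
    obtain ⟨a, ha, -⟩ := HenselianLocalRing.is_henselian
      (Polynomial.X ^ 2 - Polynomial.C b) (Polynomial.monic_X_pow_sub_C b two_ne_zero) a₀
      (by
        rw [← residue_eq_zero_iff]
        simp [hy, sq])
      (by simpa [one_add_one_eq_two] using h2.mul ha₀)
    have hab : a ^ 2 = b := by simpa [sub_eq_zero] using ha
    have hau : IsUnit a := isUnit_pow_iff two_ne_zero |>.mp (hab ▸ hb)
    exact hsq ⟨hau.unit, by simpa using hab.symm⟩
  · have hb0 : residue R b = 0 := by
      by_contra h
      exact hb ((residue_ne_zero_iff_isUnit b).mp h)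
    rw [hb0, MulChar.map_zero]

/-- `N` counts the nonzero residue vectors at which form plus `a` vanishes. The nonzero classes with
unit values have total volume 1 - q^{-r} - N q^{-r}, and each of the `N` others contributes q^{-r} t
g. -/
theorem tableI_eq_of_count (h2 : IsUnit (2 : R)) {ι : Type*} [Fintype ι] [DecidableEq ι]
    {M : Matrix ι ι R} (hM : M.IsSymm) {d u : Rˣ} (hdet : M.det = d * (u : R) ^ 2) {r : ℕ}
    (hr : Fintype.card ι = r) (a : R) {t : ℂ} (ht : 1 - t / (residueCard R : ℂ) ≠ 0) {N : ℂ}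
    (hN : N = countForm (M.map (residue R)) (-residue R a) -
      if residue R a = 0 then 1 else 0) :
    tableI a r (d : R) t = 1 - 1 / (residueCard R : ℂ) ^ r - N / (residueCard R : ℂ) ^ r +
      N / (residueCard R : ℂ) ^ r * (t * geom (residueCard R) t) := by
  have hF := ringChar_residueField_ne_two h2
  have hMF : (M.map (residue R)).IsSymm := hM.map _
  obtain ⟨w, v, hv, hprod, hcount⟩ := exists_countForm_eq_countDiag hF hMF hr
  have hdF : (M.map (residue R)).det = residue R d * residue R u ^ 2 := by
    rw [← RingHom.mapMatrix_apply, ← RingHom.map_det, hdet, map_mul, map_pow]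
  have hu0 : residue R u ≠ 0 := (residue_ne_zero_iff_isUnit _).mpr u.isUnit
  have hd0 : residue R d ≠ 0 := (residue_ne_zero_iff_isUnit _).mpr d.isUnit
  have hw : ∀ i, w i ≠ 0 := by
    intro i hi
    rw [Finset.prod_eq_zero (Finset.mem_univ i) hi, hdF] at hprod
    exact mul_ne_zero (mul_ne_zero hd0 (pow_ne_zero 2 hu0)) (pow_ne_zero 2 hv) hprod.symm
  have hχ (x : ResidueField R) : quadraticChar _ (x * ∏ i, w i) =
      quadraticChar _ (x * residue R d) := by
    rw [hprod, hdF]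
    have : x * (residue R ↑d * residue R ↑u ^ 2 * v ^ 2) =
      x * residue R d * (residue R u * v) ^ 2 := by ring
    rw [this, map_mul, quadraticChar_sq_one' (mul_ne_zero hu0 hv), mul_one]
  have hmem : a ∈ maximalIdeal R ↔ residue R a = 0 := (residue_eq_zero_iff a).symm
  have hqF : Fintype.card (ResidueField R) = residueCard R := by
    rw [residueCard, Nat.card_eq_fintype_card]
  have hq0 : (residueCard R : ℂ) ≠ 0 := by
    rw [← hqF]; exact_mod_cast Fintype.card_ne_zero
  set q : ℂ := (residueCard R : ℂ) with hq
  have hg : geom (residueCard R) t = 1 - 1 / q + t * geom (residueCard R) t / q := by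
    have hqt : q - t ≠ 0 := by
      intro h
      rw [← sub_eq_zero.mp h, div_self hq0, sub_self] at ht
      exact ht rfl
    rw [geom, ← hq]
    field_simp
    ring
  obtain ⟨g, hgd⟩ : ∃ g, geom (residueCard R) t = g := ⟨_, rfl⟩
  rw [hgd] at hg ⊢
  -- The relation (1 - t/q) g = 1 - 1/q cleared of denominators; nothing else about `g` is used
  -- below.
  have hg' : t * g = q * g - q + 1 := by
    field_simp at hg
    linear_combination -hg
  rcases Nat.even_or_odd r with ⟨m, hm⟩ | ⟨m, hm⟩
  · obtain rfl : r = 2 * m := by omega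
    have hc := (countDiag_even_and_odd hF m).1 w hw (-residue R a)
    rw [← hcount, hχ, hqF] at hc
    simp only [neg_eq_zero] at hc
    have he : eta ((-1) ^ (2 * m / 2) * (d : R)) =
        quadraticChar (ResidueField R) ((-1) ^ m * residue R d) := by
      rw [eta_eq_quadraticChar h2, Nat.mul_div_cancel_left m two_pos]
      simp
    have hne : (-1) ^ m * residue R d ≠ 0 :=
      mul_ne_zero (pow_ne_zero m (neg_ne_zero.mpr one_ne_zero)) hd0
    have hsq : ((quadraticChar (ResidueField R) ((-1) ^ m * residue R d) : ℤ) : ℂ) ^ 2 = 1 := by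
      exact_mod_cast quadraticChar_sq_one hne
    have hc' := congrArg (Int.cast : ℤ → ℂ) hc
    simp only [tableI, Nat.not_odd_iff_even.mpr (even_two_mul m), if_false, hmem, he, hgd]
    rw [Nat.mul_div_cancel_left m two_pos]
    push_cast at hc'
    rw [← hq] at hc' ⊢
    set E : ℂ := ((quadraticChar (ResidueField R) ((-1) ^ m * residue R d) : ℤ) : ℂ)
    set C : ℂ := (countForm (M.map (residue R)) (-residue R a) : ℂ)
    rw [pow_mul'] at hc' ⊢
    have hQ : q ^ m ≠ 0 := pow_ne_zero m hq0
    set Q := q ^ m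
    split_ifs with h0
    · simp only [h0, if_true] at hc' hN
      have hC : C = (Q ^ 2 + E * Q * (q - 1)) / q := by rw [← hc']; field_simp
      rw [hN, hC]
      field_simp
      linear_combination (-Q ^ 2 + E * Q) * hg' - q * t * g * hsq
    · simp only [h0, if_false] at hc' hN
      have hC : C = (Q ^ 2 - E * Q) / q := by
        rw [eq_div_iff hq0]; linear_combination hc'
      rw [hN, hC]
      field_simp
      linear_combination (-Q ^ 2 + E * Q) * hg' - q * hsq
  · subst hm
    have hc := (countDiag_even_and_odd hF m).2 w hw (-residue R a)
    -- The exponent (r + 1)/2 = m + 1 exceeds the m of the count because the form is to take the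
    -- value -a, which supplies one more sign.
    have he : eta (a * (-1) ^ ((2 * m + 1 + 1) / 2) * (d : R)) =
        quadraticChar (ResidueField R) ((-1) ^ m * (∏ i, w i) * -residue R a) := by
      rw [eta_eq_quadraticChar h2, show (2 * m + 1 + 1) / 2 = m + 1 by omega,
        mul_right_comm _ (∏ i, w i), hχ]
      congr 1
      simp [pow_succ]
      ring
    rw [← hcount, ← he, hqF] at hc
    have hc' := congrArg (Int.cast : ℤ → ℂ) hc
    simp only [tableI, odd_two_mul_add_one, if_true, hmem, hgd]
    push_cast at hc'
    rw [← hq] at hc' ⊢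
    rw [show (2 * m + 1 + 1) / 2 = m + 1 by omega] at hc' ⊢
    set E : ℂ := ((eta (a * (-1) ^ (m + 1) * (d : R)) : ℤ) : ℂ) with hE
    set C : ℂ := (countForm (M.map (residue R)) (-residue R a) : ℂ)
    rw [pow_mul'] at hc'
    rw [pow_succ q (2 * m), pow_succ q m, pow_mul']
    have hQ : q ^ m ≠ 0 := pow_ne_zero m hq0
    set Q := q ^ m
    split_ifs with h0
    · have hE0 : E = 0 := by
        rw [hE, eta_eq_quadraticChar h2]
        simp [h0]
      simp only [h0, if_true] at hN
      rw [hN, hc', hE0]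
      field_simp
      linear_combination (-Q ^ 2) * hg'
    · simp only [h0, if_false] at hN
      rw [hN, hc']
      field_simp
      linear_combination (-Q ^ 2) * hg'

end Table

/-! ### Integration over the residue classes of the unimodular part -/

section QuadraticStep

open IsLocalRing Matrix

section Algebra

variable {A : Type*} [CommRing A] {ι σ : Type*} [Fintype ι] [DecidableEq ι]

/-- The value of the quadratic form with matrix `M` at `x`. -/
def formEval (M : Matrix ι ι A) (x : ι → A) : A :=
  ∑ i, ∑ j, M i j * x i * x j

theorem formEval_eq_dotProduct (M : Matrix ι ι A) (x : ι → A) : formEval M x = x ⬝ᵥ M *ᵥ x := by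
  simp only [formEval, dotProduct, mulVec, Finset.mul_sum]
  exact Finset.sum_congr rfl fun i _ => Finset.sum_congr rfl fun j _ => by ring

theorem formEval_smul (M : Matrix ι ι A) (a : A) (x : ι → A) :
    formEval M (a • x) = a ^ 2 * formEval M x := by
  simp only [formEval, Finset.mul_sum, Pi.smul_apply, smul_eq_mul]
  exact Finset.sum_congr rfl fun i _ => Finset.sum_congr rfl fun j _ => by ring

theorem map_formEval {B : Type*} [CommRing B] (g : A →+* B) (M : Matrix ι ι A) (x : ι → A) :
    g (formEval M x) = formEval (M.map g) (g ∘ x) := by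
  simp [formEval]

/-- Taylor expansion in one coordinate: the factor is the partial derivative 2(Mx)_i up to a
multiple of v - w, hence a unit if that derivative is one and v ≡ w mod π. -/
theorem formEval_update_sub {M : Matrix ι ι A} (hM : M.IsSymm) (x : ι → A) (i : ι) (v w : A) :
    formEval M (Function.update x i v) - formEval M (Function.update x i w) =
      (2 * (M *ᵥ Function.update x i v) i - M i i * (v - w)) * (v - w) := by
  set X := Function.update x i v
  have hX : Function.update x i w = X - Pi.single i (v - w) := by
    ext j
    by_cases h : j = i
    · subst h; simp [X]
    · simp [X, h]
  have hs : X ⬝ᵥ M *ᵥ Pi.single i (v - w) = (v - w) * (M *ᵥ X) i := by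
    rw [dotProduct_mulVec, ← mulVec_transpose, hM.eq, dotProduct_single, mul_comm]
  rw [formEval_eq_dotProduct, formEval_eq_dotProduct, hX, mulVec_sub, sub_dotProduct,
    dotProduct_sub, dotProduct_sub, hs, single_dotProduct, single_dotProduct]
  simp
  ring

end Algebra

variable {R : Type*} [CommRing R] [IsDomain R] [IsDiscreteValuationRing R]
  [Fintype (ResidueField R)] [DecidableEq (ResidueField R)]
  [TopologicalSpace R] [IsTopologicalRing R] [CompactSpace R] [MeasurableSpace R]
  [BorelSpace R] [T2Space R] {π : R}
  {ι σ : Type*} [Fintype ι] [DecidableEq ι] [Fintype σ] {f : (σ → R) → R}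

theorem residue_eq_zero_iff_dvd (hπ : Irreducible π) (x : R) : residue R x = 0 ↔ π ∣ x := by
  rw [residue_eq_zero_iff, hπ.maximalIdeal_eq, Ideal.mem_span_singleton]

theorem isUnit_of_residue_ne_zero {x : R} (hx : residue R x ≠ 0) : IsUnit x :=
  (residue_ne_zero_iff_isUnit x).mp hx

theorem measurableSet_dvd_comp {g : (σ → R) → (σ → R)} (hg : Measurable g)
    (hf : ∀ k, MeasurableSet {x | π ^ k ∣ f x}) (k : ℕ) : MeasurableSet {x | π ^ k ∣ f (g x)} :=
  hg (hf k)

open Classical in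
theorem integral_of_update_sub (hπ : Irreducible π) (hf : ∀ k, MeasurableSet {x | π ^ k ∣ f x})
    (i : σ) (hi : ∀ x v w, ∃ u : Rˣ,
      f (Function.update x i v) - f (Function.update x i w) = u * (v - w)) {s : ℂ} (hs : 0 < s.re) :
    ∫ x, (absVal (f x) : ℂ) ^ s ∂(haar R σ) =
      geom (residueCard R) ((residueCard R : ℂ) ^ (-s)) :=
  integral_absVal_cpow_of_uniform hπ hf (haar_dvd_of_update hπ hf i hi) hs

open Classical in
theorem integral_of_update_sub_pi_mul (hπ : Irreducible π)
    (hf : ∀ k, MeasurableSet {x | π ^ k ∣ f x}) (hdvd : ∀ x, π ∣ f x)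
    (i : σ) (hi : ∀ x v w, ∃ u : Rˣ,
      f (Function.update x i v) - f (Function.update x i w) = π * (u * (v - w)))
    {s : ℂ} (hs : 0 < s.re) :
    ∫ x, (absVal (f x) : ℂ) ^ s ∂(haar R σ) =
      (residueCard R : ℂ) ^ (-s) * geom (residueCard R) ((residueCard R : ℂ) ^ (-s)) := by
  choose h hh using hdvd
  have hm (k : ℕ) : MeasurableSet {x | π ^ k ∣ h x} := by
    convert hf (k + 1) using 1
    ext x
    rw [Set.mem_ofPred_eq, Set.mem_ofPred_eq, hh, pow_succ', mul_dvd_mul_iff_left hπ.ne_zero]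
  rw [← integral_of_update_sub hπ hm i _ hs, ← integral_const_mul]
  · simp_rw [hh, absVal_pi_mul_cpow hπ]
  · intro x v w
    obtain ⟨u, hu⟩ := hi x v w
    refine ⟨u, mul_left_cancel₀ hπ.ne_zero ?_⟩
    rw [← hu, hh, hh, mul_sub]

/-- A function which is a quadratic form in the coordinates `e i`, up to a summand `H` not
depending on them which is congruent to `a`. -/
structure IsFormPlus (π : R) (f : (σ → R) → R) (e : ι ↪ σ) (M : Matrix ι ι R) (a : R) : Prop where
  symm : M.IsSymm
  isUnit_det : IsUnit M.det
  measurable : ∀ k, MeasurableSet {x | π ^ k ∣ f x}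
  residue_eq : ∀ x, residue R (f x) = formEval (M.map (residue R)) (fun i => residue R (x (e i))) +
    residue R a
  update_sub : ∀ (x y : σ → R), (∀ j, j ∉ Set.range e → x j = y j) →
    f x - f y = formEval M (fun i => x (e i)) - formEval M (fun i => y (e i))

open Classical in
theorem IsFormPlus.integral_dilate (hπ : Irreducible π) (h2 : IsUnit (2 : R)) {e : ι ↪ σ}
    {M : Matrix ι ι R} {a : R} (hf : IsFormPlus π f e M a) {z : σ → R}
    (hz : (fun i => residue R (z (e i))) ≠ 0) {s : ℂ} (hs : 0 < s.re) :
    ∫ y, (absVal (f (dilate π (Set.range e) z y)) : ℂ) ^ s ∂(haar R σ) =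
      if formEval (M.map (residue R)) (fun i => residue R (z (e i))) = -residue R a then
        (residueCard R : ℂ) ^ (-s) * geom (residueCard R) ((residueCard R : ℂ) ^ (-s)) else 1 := by
  have hd (y : σ → R) (i : ι) : dilate π (Set.range e) z y (e i) = z (e i) + π * y (e i) := by
    simp [dilate]
  have hπ0 : residue R π = 0 := (residue_eq_zero_iff_dvd hπ π).mpr dvd_rfl
  have hdr (y : σ → R) (i : ι) :
      residue R (dilate π (Set.range e) z y (e i)) = residue R (z (e i)) := by
    rw [hd, map_add, map_mul, hπ0, zero_mul, add_zero]
  have hres (y : σ → R) : residue R (f (dilate π (Set.range e) z y)) =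
      formEval (M.map (residue R)) (fun i => residue R (z (e i))) + residue R a := by
    rw [hf.residue_eq]
    simp_rw [hdr]
  split_ifs with h0
  · have hdet : IsUnit (M.map (residue R)).det := by
      rw [← RingHom.mapMatrix_apply, ← RingHom.map_det]
      exact hf.isUnit_det.map _
    -- `M` is invertible modulo `π` and `z` is nonzero there, so some partial derivative does not
    -- vanish.
    obtain ⟨i, hi⟩ : ∃ i, (M.map (residue R) *ᵥ fun i => residue R (z (e i))) i ≠ 0 := by
      by_contra hcon
      push Not at hcon
      apply hz
      have hinj := mulVec_injective_iff_isUnit.mpr ((isUnit_iff_isUnit_det _).mpr hdet)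
      refine hinj ?_
      rw [mulVec_zero]
      exact _root_.funext hcon
    refine integral_of_update_sub_pi_mul hπ
      (fun k => measurableSet_dvd_comp (measurable_dilate _ z) hf.measurable k) (fun y => ?_)
      (e i) (fun y v w => ?_) hs
    · rw [← residue_eq_zero_iff_dvd hπ, hres, h0, neg_add_cancel]
    · set x := fun j => dilate π (Set.range e) z y (e j) with hx
      have hup (v : R) : (fun j => dilate π (Set.range e) z (Function.update y (e i) v) (e j)) =
          Function.update x i (z (e i) + π * v) := by
        funext j
        by_cases hj : j = i
        · subst hj; simp [hd]
        · simp [hd, hj, hx]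
      have hsub := hf.update_sub (dilate π (Set.range e) z (Function.update y (e i) v))
        (dilate π (Set.range e) z (Function.update y (e i) w)) (fun j hj => by
          have hji : j ≠ e i := fun h => hj ⟨i, h.symm⟩
          simp [dilate, hj, hji])
      rw [hup, hup, formEval_update_sub hf.symm] at hsub
      -- The dilated coordinate moves by π(v - w), so the quadratic correction vanishes modulo `π`.
      have hunit : IsUnit (2 * (M *ᵥ Function.update x i (z (e i) + π * v)) i -
          M i i * (z (e i) + π * v - (z (e i) + π * w))) := by
        apply isUnit_of_residue_ne_zero
        have h1 : residue R ((M *ᵥ Function.update x i (z (e i) + π * v)) i) =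
            (M.map (residue R) *ᵥ fun i => residue R (z (e i))) i := by
          rw [← hup, RingHom.map_mulVec]
          congr 1
          funext j
          exact hdr _ j
        rw [map_sub, map_mul, map_mul, h1]
        simp only [map_sub, map_add, map_mul, hπ0]
        simp only [zero_mul, add_zero, sub_self, mul_zero, sub_zero]
        exact mul_ne_zero ((residue_ne_zero_iff_isUnit 2).mpr h2) hi
      refine ⟨hunit.unit, ?_⟩
      rw [hsub, IsUnit.unit_spec]
      ring
  · have hone (y : σ → R) : (absVal (f (dilate π (Set.range e) z y)) : ℂ) ^ s = 1 := by
      refine absVal_cpow_of_isUnit (isUnit_of_residue_ne_zero ?_) s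
      rw [hres]
      exact fun h => h0 (eq_neg_of_add_eq_zero_left h)
    simp_rw [hone]
    simp

open Classical in
theorem integral_eq_sum_residues (hπ : Irreducible π) (e : ι ↪ σ) {G : (σ → R) → ℂ}
    (hG : Measurable G) (hGi : Integrable G (haar R σ)) {lift : ResidueField R → R}
    (hlift : ∀ x, residue R (lift x) = x) :
    ∫ x, G x ∂(haar R σ) = ∑ z : ι → ResidueField R,
      ((residueCard R : ℂ) ^ Fintype.card ι)⁻¹ *
        ∫ y, G (dilate π (Set.range e) (Function.extend e (fun i => lift (z i)) 0) y)
          ∂(haar R σ) := by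
  have hcard : (Set.range e).ncard = Fintype.card ι := by
    rw [← Set.image_univ, Set.ncard_image_of_injective _ e.injective, Set.ncard_univ,
      Nat.card_eq_fintype_card]
  have hmem (z : ι → ResidueField R) (x : σ → R) :
      x ∈ {x : σ → R | ∀ j ∈ Set.range e,
        π ∣ x j - Function.extend e (fun i => lift (z i)) 0 j} ↔
      (fun i => residue R (x (e i))) = z := by
    simp only [Set.mem_ofPred_eq, Set.forall_mem_range, e.injective.extend_apply, funext_iff]
    refine forall_congr' fun i => ?_
    rw [← residue_eq_zero_iff_dvd hπ, map_sub, hlift, sub_eq_zero]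
  rw [← setIntegral_univ, show (Set.univ : Set (σ → R)) = ⋃ z : ι → ResidueField R,
    {x : σ → R | ∀ j ∈ Set.range e, π ∣ x j - Function.extend e (fun i => lift (z i)) 0 j} by
      ext x
      simp only [Set.mem_univ, Set.mem_iUnion, hmem, exists_eq'],
    integral_iUnion_fintype (fun z => measurableSet_dvd_on _ _) ?_
      (fun z => hGi.integrableOn)]
  · refine Finset.sum_congr rfl fun z _ => ?_
    rw [setIntegral_haar hπ _ _ hG, hcard]
  · intro z z' hzz
    rw [Function.onFun, Set.disjoint_left]
    intro x hx hx'
    rw [hmem] at hx hx'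
    exact hzz (hx.symm.trans hx')

open Classical in
-- The nonzero residue classes sum to the table entry; the zero class is kept as the remainder on
-- which the recursion acts.
theorem IsFormPlus.integral_eq [HenselianLocalRing R] (hπ : Irreducible π) (h2 : IsUnit (2 : R))
    {e : ι ↪ σ} {M : Matrix ι ι R} {a : R} (hf : IsFormPlus π f e M a) {d u : Rˣ}
    (hdet : M.det = d * (u : R) ^ 2) {r : ℕ} (hr : Fintype.card ι = r) {s : ℂ} (hs : 0 < s.re) :
    ∫ x, (absVal (f x) : ℂ) ^ s ∂(haar R σ) =
      tableI a r (d : R) ((residueCard R : ℂ) ^ (-s)) + ((residueCard R : ℂ) ^ r)⁻¹ *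
        ∫ y, (absVal (f (dilate π (Set.range e) 0 y)) : ℂ) ^ s ∂(haar R σ) := by
  have hs0 : s ≠ 0 := by rintro rfl; simp at hs
  -- The lift fixes 0 so that the zero class is dilated about the origin itself.
  obtain ⟨lift, hlift, hlift0⟩ : ∃ lift : ResidueField R → R,
      (∀ x, residue R (lift x) = x) ∧ lift 0 = 0 := by
    choose l hl using residue_surjective (R := R)
    refine ⟨Function.update l 0 0, fun x => ?_, by simp⟩
    by_cases hx : x = 0
    · simp [hx]
    · simp [hx, hl]
  rw [integral_eq_sum_residues hπ e (measurable_absVal_cpow hπ hf.measurable hs0)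
    (integrable_absVal_cpow hπ hf.measurable hs) hlift, ← Finset.add_sum_erase _ _
    (Finset.mem_univ 0), add_comm, hr]
  have htab := tableI_eq_of_count h2 hf.symm hdet hr a
    (one_sub_div_ne_zero (norm_card_cpow_lt_one (R := R) hs)) rfl
  set t := (residueCard R : ℂ) ^ (-s)
  set q : ℂ := (residueCard R : ℂ) with hq
  have hq0 : q ≠ 0 := by rw [hq]; exact_mod_cast (residueCard_pos (R := R)).ne'
  congr 1
  · have hterm (z : ι → ResidueField R) (hz : z ∈ Finset.univ.erase 0) :
        (q ^ r)⁻¹ * ∫ y, (absVal (f (dilate π (Set.range e)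
          (Function.extend e (fun i => lift (z i)) 0) y)) : ℂ) ^ s ∂(haar R σ) =
        (q ^ r)⁻¹ * (1 + (if formEval (M.map (residue R)) z = -residue R a then 1 else 0) *
          (t * geom (residueCard R) t - 1)) := by
      have hze : (fun i => residue R (Function.extend e (fun i => lift (z i)) 0 (e i))) = z := by
        funext i
        rw [e.injective.extend_apply, hlift]
      rw [hf.integral_dilate hπ h2 (by rw [hze]; exact Finset.ne_of_mem_erase hz) hs, hze]
      split_ifs <;> simp [t]
    rw [Finset.sum_congr rfl hterm, ← Finset.mul_sum, Finset.sum_add_distrib, ← Finset.sum_mul,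
      htab]
    have hcard : (∑ x ∈ (Finset.univ : Finset (ι → ResidueField R)).erase 0, (1 : ℂ)) =
        q ^ r - 1 := by
      rw [Finset.sum_const, Finset.card_erase_of_mem (Finset.mem_univ _), Finset.card_univ,
        Fintype.card_fun, hr, nsmul_eq_mul, mul_one, Nat.cast_sub, ← Nat.card_eq_fintype_card,
        ← residueCard, Nat.cast_pow, Nat.cast_one]
      exact Nat.one_le_pow _ _ Fintype.card_pos
    have hcount : (∑ x ∈ (Finset.univ : Finset (ι → ResidueField R)).erase 0,
        (if formEval (M.map (residue R)) x = -residue R a then (1 : ℂ) else 0)) =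
        countForm (M.map (residue R)) (-residue R a) - if residue R a = 0 then 1 else 0 := by
      have hcf : (countForm (M.map (residue R)) (-residue R a) : ℂ) =
          ∑ x, if formEval (M.map (residue R)) x = -residue R a then (1 : ℂ) else 0 := by
        rw [countForm, Int.cast_sum]
        refine Finset.sum_congr rfl fun x _ => ?_
        change _ = if ∑ i, ∑ j, M.map (residue R) i j * x i * x j = -residue R a then (1 : ℂ) else 0
        split_ifs <;> simp
      rw [eq_sub_iff_add_eq, hcf, ← Finset.sum_erase_add Finset.univ _ (Finset.mem_univ 0)]
      congr 1
      simp [formEval, eq_comm]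
    rw [hcard, hcount]
    field_simp
    ring
  · congr 3
    have : Function.extend e (fun i => lift ((0 : ι → ResidueField R) i)) 0 = (0 : σ → R) := by
      funext j
      by_cases hj : ∃ i, e i = j
      · obtain ⟨i, rfl⟩ := hj
        rw [e.injective.extend_apply]
        simpa using hlift0
      · rw [Function.extend_apply' _ _ _ hj]
    rw [this]

end QuadraticStep

/-! ### Orthogonal sums of forms, and the indeterminates of a unimodular form -/

section Block

open Matrix

variable {A : Type*} [CommRing A]

theorem det_blockDiagonal_sigma {o : Type*} [Fintype o] [DecidableEq o] {n : o → Type*}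
    [∀ i, Fintype (n i)] [∀ i, DecidableEq (n i)] (M : ∀ i, Matrix (n i) (n i) A) :
    (blockDiagonal' M).det = ∏ i, (M i).det := by
  -- Any order on the blocks serves to view the matrix as block triangular.
  let _ : LinearOrder o := LinearOrder.lift' (Fintype.equivFin o) (Fintype.equivFin o).injective
  rw [(blockTriangular_blockDiagonal' M).det_fintype]
  refine Finset.prod_congr rfl fun k _ => ?_
  let e : n k ≃ {a : Σ i, n i // a.1 = k} :=
    { toFun := fun x => ⟨⟨k, x⟩, rfl⟩
      invFun := fun x => x.2 ▸ x.1.2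
      left_inv := fun x => rfl
      right_inv := by rintro ⟨⟨i, x⟩, rfl⟩; rfl }
  rw [← det_submatrix_equiv_self e]
  congr 1
  ext x y
  simp [e, toSquareBlock, toSquareBlockProp, blockDiagonal'_apply_eq]

theorem formEval_blockDiagonal {o : Type*} [Fintype o] [DecidableEq o] {n : o → Type*}
    [∀ i, Fintype (n i)] [∀ i, DecidableEq (n i)] (M : ∀ i, Matrix (n i) (n i) A)
    (x : (Σ i, n i) → A) :
    formEval (blockDiagonal' M) x = ∑ i, formEval (M i) (fun k => x ⟨i, k⟩) := by
  simp only [formEval, Fintype.sum_sigma]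
  refine Finset.sum_congr rfl fun i _ => Finset.sum_congr rfl fun k _ => ?_
  rw [Finset.sum_eq_single i]
  · simp [blockDiagonal'_apply_eq]
  · intro j _ hj
    refine Finset.sum_eq_zero fun l _ => ?_
    rw [blockDiagonal'_apply_ne M k l hj.symm, zero_mul, zero_mul]
  · simp

theorem eval_formOfMatrix {σ : Type*} {r : ℕ} (e : Fin r ↪ σ) (M : Matrix (Fin r) (Fin r) A)
    (x : σ → A) : eval x (formOfMatrix e M) = formEval M (fun i => x (e i)) := by
  simp [formOfMatrix, formEval]

/-- Turns disjointness of `vars` into disjointness of the embeddings. Were the form independent of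
one coordinate, its Taylor expansion there would vanish identically. -/
theorem mem_vars_formOfMatrix [Nontrivial A] (h2 : IsUnit (2 : A)) {σ : Type*} {r : ℕ}
    (e : Fin r ↪ σ) {M : Matrix (Fin r) (Fin r) A} (hM : M.IsSymm) (hdet : IsUnit M.det)
    (k : Fin r) : e k ∈ (formOfMatrix e M).vars := by
  classical
  by_contra hk
  have hconst (x : Fin r → A) (w : A) : formEval M x = formEval M (Function.update x k w) := by
    have hx : (fun i => Function.extend e x 0 (e i)) = x := by
      funext i; exact e.injective.extend_apply _ _ _
    have hu : (fun i => Function.update (Function.extend e x 0) (e k) w (e i)) =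
        Function.update x k w := by
      funext i
      by_cases h : i = k
      · subst h; simp
      · simp [h, e.injective.extend_apply]
    rw [← hu, ← eval_formOfMatrix, ← congrArg (formEval M) hx, ← eval_formOfMatrix]
    refine eval₂Hom_congr' rfl ?_ rfl
    intro i hi _
    have : i ≠ e k := fun h => hk (h ▸ hi)
    simp [this]
  have hsub (x : Fin r → A) (δ : A) : (2 * (M *ᵥ x) k - M k k * δ) * δ = 0 := by
    have h := formEval_update_sub hM x k (x k) (x k - δ)
    rw [Function.update_eq_self, ← hconst, sub_self, sub_sub_cancel] at h
    exact h.symm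
  -- With this, the choice x = M⁻¹e_k in `hsub` yields 2 = 0.
  have hkk : M k k = 0 := by simpa using hsub 0 1
  have hx := hsub (M⁻¹ *ᵥ Pi.single k 1) 1
  rw [mulVec_mulVec, mul_nonsing_inv _ hdet, one_mulVec, hkk] at hx
  simp only [Pi.single_eq_same, mul_one, sub_zero] at hx
  exact h2.ne_zero hx

end Block

/-! ### One step of the recursion and its two terminal cases -/

section Recursion

open IsLocalRing Matrix

variable {R : Type*} [CommRing R] {σ : Type*}

/-- A finite family of unimodular forms in pairwise disjoint sets of indeterminates, together with
at most one further indeterminate. -/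
structure FormData (R σ : Type*) [CommRing R] (r : ℕ → ℕ) where
  emb : ∀ i, Fin (r i) ↪ σ
  mat : ∀ i, Matrix (Fin (r i)) (Fin (r i)) R
  lin : Option σ
  bound : ℕ
  symm : ∀ i, (mat i).IsSymm
  isUnit_det : ∀ i, IsUnit (mat i).det
  emb_ne : ∀ i j, i ≠ j → ∀ k l, emb i k ≠ emb j l
  lin_ne : ∀ i k, lin ≠ some (emb i k)

namespace FormData

variable {r : ℕ → ℕ} (D : FormData R σ r)

/-- The polynomial `∑ π ^ (e i) Q_i + b x + c`. -/
noncomputable def poly (π : R) (e : ℕ → ℕ) (b c : R) : MvPolynomial σ R :=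
  ∑ i ∈ Finset.range D.bound, C (π ^ e i) * formOfMatrix (D.emb i) (D.mat i) +
    C b * D.lin.elim 0 X + C c

/-- The value of the `i`-th form. -/
def formVal (i : ℕ) (x : σ → R) : R := formEval (D.mat i) (fun k => x (D.emb i k))

theorem eval_poly (π : R) (e : ℕ → ℕ) (b c : R) (x : σ → R) :
    eval x (D.poly π e b c) =
      ∑ i ∈ Finset.range D.bound, π ^ e i * D.formVal i x + b * D.lin.elim 0 x + c := by
  have : eval x (D.lin.elim 0 X) = D.lin.elim 0 x := by
    cases D.lin <;> simp
  simp [poly, eval_formOfMatrix, formVal, this]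

theorem formVal_congr {i : ℕ} {x y : σ → R} (h : ∀ k, x (D.emb i k) = y (D.emb i k)) :
    D.formVal i x = D.formVal i y := by
  simp [formVal, h]

/-- The indices of the forms with exponent `0`. -/
def zeros (e : ℕ → ℕ) : Finset ℕ := (Finset.range D.bound).filter (fun i => e i = 0)

/-- The indeterminates of the forms with exponent `0`. -/
def embZeros (e : ℕ → ℕ) : (Σ i : D.zeros e, Fin (r i)) ↪ σ where
  toFun k := D.emb k.1 k.2
  inj' := by
    rintro ⟨⟨i, hi⟩, k⟩ ⟨⟨j, hj⟩, l⟩ h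
    by_cases hij : i = j
    · subst hij
      simpa using h
    · exact absurd h (D.emb_ne i j hij k l)

/-- The matrix of the sum of the forms with exponent `0`. -/
def matZeros (e : ℕ → ℕ) : Matrix (Σ i : D.zeros e, Fin (r i)) (Σ i : D.zeros e, Fin (r i)) R :=
  blockDiagonal' fun i : D.zeros e => D.mat i

theorem emb_mem_range_iff {e : ℕ → ℕ} {i : ℕ} (hi : i < D.bound) (k : Fin (r i)) :
    D.emb i k ∈ Set.range (D.embZeros e) ↔ e i = 0 := by
  constructor
  · rintro ⟨⟨⟨j, hj⟩, l⟩, h⟩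
    by_cases hij : j = i
    · subst hij
      exact (Finset.mem_filter.mp hj).2
    · exact absurd h (D.emb_ne j i hij l k)
  · intro h
    exact ⟨⟨⟨i, Finset.mem_filter.mpr ⟨Finset.mem_range.mpr hi, h⟩⟩, k⟩, rfl⟩

theorem lin_notMem_range {e : ℕ → ℕ} {x : σ} (hx : D.lin = some x) :
    x ∉ Set.range (D.embZeros e) := by
  rintro ⟨⟨⟨i, hi⟩, k⟩, rfl⟩
  exact D.lin_ne i k hx

theorem formEval_matZeros (e : ℕ → ℕ) (x : σ → R) :
    formEval (D.matZeros e) (fun k => x (D.embZeros e k)) = ∑ i ∈ D.zeros e, D.formVal i x := by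
  rw [matZeros, formEval_blockDiagonal]
  exact Finset.sum_coe_sort (D.zeros e) (fun i => D.formVal i x)

theorem card_sigma_zeros (e : ℕ → ℕ) :
    Fintype.card (Σ i : D.zeros e, Fin (r i)) = ∑ i ∈ D.zeros e, r i := by
  simp only [Fintype.card_sigma, Fintype.card_fin]
  exact Finset.sum_coe_sort (D.zeros e) r

theorem det_matZeros (e : ℕ → ℕ) : (D.matZeros e).det = ∏ i ∈ D.zeros e, (D.mat i).det := by
  rw [matZeros, det_blockDiagonal_sigma]
  exact Finset.prod_coe_sort (D.zeros e) (fun i => (D.mat i).det)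

theorem eval_poly_eq (π : R) (e : ℕ → ℕ) (b c : R) (x : σ → R) :
    eval x (D.poly π e b c) = formEval (D.matZeros e) (fun k => x (D.embZeros e k)) +
      (∑ i ∈ (Finset.range D.bound).filter (fun i => e i ≠ 0), π ^ e i * D.formVal i x +
        b * D.lin.elim 0 x + c) := by
  rw [eval_poly, formEval_matZeros,
    ← Finset.sum_filter_add_sum_filter_not (Finset.range D.bound) (fun i => e i = 0)]
  have : ∑ i ∈ (Finset.range D.bound).filter (fun i => e i = 0), π ^ e i * D.formVal i x =
      ∑ i ∈ D.zeros e, D.formVal i x :=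
    Finset.sum_congr rfl fun i hi => by rw [(Finset.mem_filter.mp hi).2, pow_zero, one_mul]
  rw [this]
  ring

/-- The exponents after substituting `π x` for the indeterminates of the forms with exponent `0`
and dividing by `π`. -/
def next (e : ℕ → ℕ) (i : ℕ) : ℕ := if e i = 0 then 1 else e i - 1

open Classical in
-- The dilated forms gain π² by homogeneity, while each other summand is undilated and already
-- divisible by `π`.
theorem eval_poly_dilate (π : R) (e : ℕ → ℕ) (b c : R) (y : σ → R) :
    eval (dilate π (Set.range (D.embZeros e)) 0 y) (D.poly π e (π * b) (π * c)) =
      π * eval y (D.poly π (next e) b c) := by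
  have hl : D.lin.elim 0 (dilate π (Set.range (D.embZeros e)) 0 y) = D.lin.elim 0 y := by
    rcases h : D.lin with _ | x
    · rfl
    · simp only [Option.elim, dilate, if_neg (D.lin_notMem_range h)]
  have hi (i : ℕ) (hi : i ∈ Finset.range D.bound) :
      π ^ e i * D.formVal i (dilate π (Set.range (D.embZeros e)) 0 y) =
        π * (π ^ next e i * D.formVal i y) := by
    rw [Finset.mem_range] at hi
    by_cases h0 : e i = 0
    · have : (fun k => dilate π (Set.range (D.embZeros e)) 0 y (D.emb i k)) =
          π • fun k => y (D.emb i k) := by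
        funext k
        simp only [dilate, if_pos ((D.emb_mem_range_iff hi k).mpr h0), Pi.zero_apply, zero_add,
          Pi.smul_apply, smul_eq_mul]
      rw [formVal, this, formEval_smul, next, if_pos h0, h0, formVal]
      ring
    · have : D.formVal i (dilate π (Set.range (D.embZeros e)) 0 y) = D.formVal i y :=
        D.formVal_congr fun k => by
          simp only [dilate, if_neg ((D.emb_mem_range_iff hi k).not.mpr h0)]
      rw [this, next, if_neg h0, ← mul_assoc, ← pow_succ', Nat.sub_add_cancel (by omega)]
  rw [eval_poly, eval_poly, hl, Finset.sum_congr rfl hi, ← Finset.mul_sum]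
  ring

variable [IsDomain R] [IsDiscreteValuationRing R] [HenselianLocalRing R]
  [Fintype (ResidueField R)] [DecidableEq (ResidueField R)]
  [TopologicalSpace R] [IsTopologicalRing R] [CompactSpace R] [MeasurableSpace R]
  [BorelSpace R] [T2Space R] {π : R} [Fintype σ]

/-- The coefficient `π * b` kills the linear term modulo `π`; `c` stays arbitrary, to serve both the
recursive step and the case of a unit constant. -/
theorem isFormPlus (hπ : Irreducible π) (e : ℕ → ℕ) (b c : R) :
    IsFormPlus π (fun x => eval x (D.poly π e (π * b) c)) (D.embZeros e) (D.matZeros e) c where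
  symm := by
    rw [IsSymm, matZeros, blockDiagonal'_transpose]
    congr 1
    funext i
    exact D.symm i
  isUnit_det := by
    rw [det_matZeros]
    exact IsUnit.prod_iff.mpr fun i _ => D.isUnit_det i
  measurable := measurableSet_dvd_eval hπ _
  residue_eq x := by
    have hπ0 : residue R π = 0 := (residue_eq_zero_iff_dvd hπ π).mpr dvd_rfl
    have h0 : residue R (∑ i ∈ (Finset.range D.bound).filter (fun i => e i ≠ 0),
        π ^ e i * D.formVal i x) = 0 := by
      rw [map_sum]
      refine Finset.sum_eq_zero fun i hi => ?_
      rw [map_mul, map_pow, hπ0, zero_pow (Finset.mem_filter.mp hi).2, zero_mul]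
    rw [eval_poly_eq, map_add, map_add, map_add, h0, map_mul, map_mul, hπ0, map_formEval]
    simp only [zero_mul, zero_add]
    rfl
  update_sub x y hxy := by
    have hl : D.lin.elim 0 x = D.lin.elim 0 y := by
      rcases h : D.lin with _ | z
      · rfl
      · exact hxy z (D.lin_notMem_range h)
    have hs : ∑ i ∈ (Finset.range D.bound).filter (fun i => e i ≠ 0), π ^ e i * D.formVal i x =
        ∑ i ∈ (Finset.range D.bound).filter (fun i => e i ≠ 0), π ^ e i * D.formVal i y := by
      refine Finset.sum_congr rfl fun i hi => ?_
      rw [Finset.mem_filter, Finset.mem_range] at hi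
      rw [D.formVal_congr fun k => hxy _ ((D.emb_mem_range_iff hi.1 k).not.mpr hi.2)]
    rw [eval_poly_eq, eval_poly_eq, hl, hs]
    ring

open Classical in
-- The indeterminate of the linear term occurs in no form and has a unit coefficient, so the values
-- are uniformly distributed whatever the forms are.
theorem zeta_of_isUnit_lin (hπ : Irreducible π) (e : ℕ → ℕ) {b : R} (hb : IsUnit b) (c : R)
    (hlin : D.lin = none → b = 0) {s : ℂ} (hs : 0 < s.re) :
    zeta (D.poly π e b c) s = geom (residueCard R) ((residueCard R : ℂ) ^ (-s)) := by
  obtain ⟨i, hi⟩ : ∃ i, D.lin = some i :=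
    Option.ne_none_iff_exists'.mp fun h => hb.ne_zero (hlin h)
  refine integral_of_update_sub hπ (measurableSet_dvd_eval hπ _) i (fun x v w => ?_) hs
  have hval (j : ℕ) (u : R) : D.formVal j (Function.update x i u) = D.formVal j x :=
    D.formVal_congr fun k => Function.update_of_ne
      (fun h => D.lin_ne j k (hi.trans (congrArg some h.symm))) _ _
  refine ⟨hb.unit, ?_⟩
  rw [eval_poly, eval_poly, hi]
  simp only [hval, Option.elim, Function.update_self, IsUnit.unit_spec]
  ring

theorem zeta_step (hπ : Irreducible π) (h2 : IsUnit (2 : R)) (e : ℕ → ℕ) (b c : R) {d u : Rˣ}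
    (hdet : ∏ i ∈ D.zeros e, (D.mat i).det = d * (u : R) ^ 2) {s : ℂ} (hs : 0 < s.re) :
    zeta (D.poly π e (π * b) (π * c)) s =
      tableI (π * c) (∑ i ∈ D.zeros e, r i) (d : R) ((residueCard R : ℂ) ^ (-s)) +
        ((residueCard R : ℂ) ^ ∑ i ∈ D.zeros e, r i)⁻¹ *
          ((residueCard R : ℂ) ^ (-s) * zeta (D.poly π (next e) b c) s) := by
  rw [zeta, zeta, ← integral_const_mul]
  unfold integrand
  rw [(D.isFormPlus hπ e b (π * c)).integral_eq hπ h2 ((D.det_matZeros e).trans hdet)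
    (D.card_sigma_zeros e) hs]
  simp_rw [eval_poly_dilate, absVal_pi_mul_cpow hπ]

theorem zeta_of_isUnit_const (hπ : Irreducible π) (h2 : IsUnit (2 : R)) (e : ℕ → ℕ) (b : R) {c : R}
    (hc : IsUnit c) {d u : Rˣ}
    (hdet : ∏ i ∈ D.zeros e, (D.mat i).det = d * (u : R) ^ 2) {s : ℂ} (hs : 0 < s.re) :
    zeta (D.poly π e (π * b) c) s =
      tableI c (∑ i ∈ D.zeros e, r i) (d : R) ((residueCard R : ℂ) ^ (-s)) +
        ((residueCard R : ℂ) ^ ∑ i ∈ D.zeros e, r i)⁻¹ := by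
  classical
  have hf := D.isFormPlus hπ e b c
  rw [zeta]
  unfold integrand
  rw [hf.integral_eq hπ h2 ((D.det_matZeros e).trans hdet) (D.card_sigma_zeros e) hs]
  have hone (y : σ → R) : (absVal (eval (dilate π (Set.range (D.embZeros e)) 0 y)
      (D.poly π e (π * b) c)) : ℂ) ^ s = 1 := by
    refine absVal_cpow_of_isUnit (isUnit_of_residue_ne_zero ?_) s
    have hπ0 : residue R π = 0 := (residue_eq_zero_iff_dvd hπ π).mpr dvd_rfl
    have hz : (fun k => residue R (dilate π (Set.range (D.embZeros e)) 0 y (D.embZeros e k))) =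
        0 := by
      funext k
      simp [dilate, hπ0]
    rw [hf.residue_eq, hz]
    simpa [formEval] using (residue_ne_zero_iff_isUnit c).mpr hc
  simp only [hone, integral_const, probReal_univ, one_smul, mul_one]

end FormData

end Recursion

/-! ### Iterating the recursion, and the three cases -/

section Reduction

open IsLocalRing

theorem tableI_of_mem_maximalIdeal {R : Type*} [CommRing R] [IsLocalRing R] {a : R}
    (ha : a ∈ maximalIdeal R) (r : ℕ) (d : R) (t : ℂ) : tableI a r d t = tableI 0 r d t := by
  simp [tableI, ha]

/-- The exponent of the `i`-th form after `j` reduction steps. -/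
def exponent (j i : ℕ) : ℕ := if j ≤ i then i - j else (j - i) % 2

/-- An exponent decreases to 0 and then alternates between 1 and 0. -/
theorem next_exponent (j : ℕ) : FormData.next (exponent j) = exponent (j + 1) := by
  funext i
  unfold FormData.next exponent
  split_ifs <;> omega

namespace FormData

variable {R σ : Type*} [CommRing R] {r : ℕ → ℕ} (D : FormData R σ r)

/-- The bound on `j` keeps the index i = j, which has exponent 0, in the range. -/
theorem zeros_exponent {j : ℕ} (hj : j < D.bound) :
    D.zeros (exponent j) = (Finset.range (j + 1)).filter (fun i => i % 2 = j % 2) := by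
  ext i
  rw [zeros, Finset.mem_filter, Finset.mem_filter, Finset.mem_range, Finset.mem_range, exponent]
  split_ifs <;> omega

theorem poly_congr (π : R) {e e' : ℕ → ℕ} (h : ∀ i < D.bound, e i = e' i) (b c : R) :
    D.poly π e b c = D.poly π e' b c := by
  rw [poly, poly, Finset.sum_congr rfl fun i hi => by rw [h i (Finset.mem_range.mp hi)]]

variable [IsDomain R] [IsDiscreteValuationRing R] [HenselianLocalRing R]
  [Fintype (ResidueField R)] [DecidableEq (ResidueField R)]
  [TopologicalSpace R] [IsTopologicalRing R] [CompactSpace R] [MeasurableSpace R]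
  [BorelSpace R] [T2Space R] {π : R} [Fintype σ] {d : ℕ → Rˣ}

theorem exists_prod_det_eq (hd : ∀ i, ∃ u : Rˣ, (D.mat i).det = d i * (u : R) ^ 2) {j : ℕ}
    (hj : j < D.bound) :
    ∃ u : Rˣ, ∏ i ∈ D.zeros (exponent j), (D.mat i).det = discTo d j * (u : R) ^ 2 := by
  choose u hu using hd
  refine ⟨∏ i ∈ D.zeros (exponent j), u i, ?_⟩
  rw [discTo, ← D.zeros_exponent hj]
  push_cast
  rw [← Finset.prod_pow, ← Finset.prod_mul_distrib]
  exact Finset.prod_congr rfl fun i _ => hu i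

theorem sum_rank_zeros {j : ℕ} (hj : j < D.bound) :
    ∑ i ∈ D.zeros (exponent j), r i = rankTo r j := by
  rw [D.zeros_exponent hj, rankTo]

theorem zeta_exponent_step (hπ : Irreducible π) (h2 : IsUnit (2 : R))
    (hd : ∀ i, ∃ u : Rˣ, (D.mat i).det = d i * (u : R) ^ 2) {j : ℕ} (hj : j < D.bound) (b c : R)
    {s : ℂ} (hs : 0 < s.re) :
    zeta (D.poly π (exponent j) (π * b) (π * c)) s =
      tableI 0 (rankTo r j) (discTo d j : R) ((residueCard R : ℂ) ^ (-s)) +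
        ((residueCard R : ℂ) ^ rankTo r j)⁻¹ *
          ((residueCard R : ℂ) ^ (-s) * zeta (D.poly π (exponent (j + 1)) b c) s) := by
  obtain ⟨u, hu⟩ := D.exists_prod_det_eq hd hj
  have hmem : π * c ∈ maximalIdeal R := by
    rw [hπ.maximalIdeal_eq, Ideal.mem_span_singleton]
    exact dvd_mul_right _ _
  rw [D.zeta_step hπ h2 _ b c hu hs, D.sum_rank_zeros hj, next_exponent,
    tableI_of_mem_maximalIdeal hmem]

theorem cardTo_succ (q : ℕ) (r : ℕ → ℕ) (n : ℕ) :
    cardTo q r (n + 1) = cardTo q r n * q ^ rankTo r n := by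
  rw [cardTo, cardTo, Finset.sum_range_succ, pow_add]

theorem zeta_iterate (hπ : Irreducible π) (h2 : IsUnit (2 : R))
    (hd : ∀ i, ∃ u : Rˣ, (D.mat i).det = d i * (u : R) ^ 2) {s : ℂ} (hs : 0 < s.re) (n : ℕ)
    (hn : n ≤ D.bound) (b c : R) :
    zeta (D.poly π (exponent 0) (π ^ n * b) (π ^ n * c)) s =
      ∑ i ∈ Finset.range n, term r d ((residueCard R : ℂ) ^ (-s)) i 0 +
        ((residueCard R : ℂ) ^ (-s)) ^ n / (cardTo (residueCard R) r n : ℂ) *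
          zeta (D.poly π (exponent n) b c) s := by
  induction n generalizing b c with
  | zero => simp [cardTo]
  | succ n ih =>
    have hq0 : (residueCard R : ℂ) ≠ 0 := by exact_mod_cast (residueCard_pos (R := R)).ne'
    have hc0 : (cardTo (residueCard R) r n : ℂ) ≠ 0 := by
      rw [cardTo]; push_cast; exact pow_ne_zero _ hq0
    rw [pow_succ, mul_assoc, mul_assoc, ih (by omega),
      D.zeta_exponent_step hπ h2 hd (by omega) b c hs,
      Finset.sum_range_succ, term, cardTo_succ]
    push_cast
    field_simp
    ring

theorem zeta_of_lin_dvd_const (hπ : Irreducible π) (h2 : IsUnit (2 : R))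
    (hd : ∀ i, ∃ u : Rˣ, (D.mat i).det = d i * (u : R) ^ 2) {s : ℂ} (hs : 0 < s.re) {n : ℕ}
    (hn : n ≤ D.bound) {b c : R} (hlin : D.lin = none → b = 0) (hb : val b = n)
    (hbc : val b ≤ val c) :
    zeta (D.poly π (exponent 0) b c) s =
      ∑ i ∈ Finset.range n, term r d ((residueCard R : ℂ) ^ (-s)) i 0 +
        ((residueCard R : ℂ) ^ (-s)) ^ n / (cardTo (residueCard R) r n : ℂ) *
          geom (residueCard R) ((residueCard R : ℂ) ^ (-s)) := by
  obtain ⟨⟨b', rfl⟩, hb'⟩ := (val_eq_coe_iff hπ n b).mp hb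
  rw [hb, le_val_iff hπ] at hbc
  obtain ⟨c', rfl⟩ := hbc
  have hunit : IsUnit b' := by
    rw [pow_succ, mul_dvd_mul_iff_left (pow_ne_zero n hπ.ne_zero),
      ← residue_eq_zero_iff_dvd hπ] at hb'
    exact isUnit_of_residue_ne_zero hb'
  rw [D.zeta_iterate hπ h2 hd hs n hn, D.zeta_of_isUnit_lin hπ _ hunit c' (fun h => by
    simpa [hπ.ne_zero] using hlin h) hs]

theorem zeta_of_const_lt_lin (hπ : Irreducible π) (h2 : IsUnit (2 : R))
    (hd : ∀ i, ∃ u : Rˣ, (D.mat i).det = d i * (u : R) ^ 2) {s : ℂ} (hs : 0 < s.re) {n : ℕ}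
    (hn : n < D.bound) {b c : R} (hc : val c = n) (hcb : val c < val b) :
    zeta (D.poly π (exponent 0) b c) s =
      ∑ i ∈ Finset.range (n + 1), term r d ((residueCard R : ℂ) ^ (-s)) i (divPow π c i) +
        ((residueCard R : ℂ) ^ (-s)) ^ n / (cardTo (residueCard R) r (n + 1) : ℂ) := by
  obtain ⟨⟨c', rfl⟩, hc'⟩ := (val_eq_coe_iff hπ n c).mp hc
  -- One factor `π` more than in the constant, so that after `n` steps the linear coefficient is
  -- still divisible by `π`.
  have hbd : π ^ (n + 1) ∣ b := by
    rw [← le_val_iff hπ, Nat.cast_add, Nat.cast_one]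
    exact Order.add_one_le_of_lt (hc ▸ hcb)
  obtain ⟨b', rfl⟩ := hbd
  have hunit : IsUnit c' := by
    rw [pow_succ, mul_dvd_mul_iff_left (pow_ne_zero n hπ.ne_zero),
      ← residue_eq_zero_iff_dvd hπ] at hc'
    exact isUnit_of_residue_ne_zero hc'
  have hdiv {i : ℕ} (hi : i ≤ n) : divPow π (π ^ n * c') i = π ^ (n - i) * c' := by
    refine mul_left_cancel₀ (pow_ne_zero i hπ.ne_zero) ?_
    rw [pow_mul_divPow ((pow_dvd_pow π hi).trans (dvd_mul_right _ _)), ← mul_assoc, ← pow_add,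
      Nat.add_sub_cancel' hi]
  have hterm : ∀ i ∈ Finset.range n,
      term r d ((residueCard R : ℂ) ^ (-s)) i (divPow π (π ^ n * c') i) =
        term r d ((residueCard R : ℂ) ^ (-s)) i 0 := by
    intro i hi
    rw [Finset.mem_range] at hi
    -- For `i < n` the constant left after `i` steps is a nonunit; only the last table entry sees
    -- its residue.
    have hmem : divPow π (π ^ n * c') i ∈ maximalIdeal R := by
      rw [hπ.maximalIdeal_eq, Ideal.mem_span_singleton, hdiv hi.le]
      exact (dvd_pow_self π (Nat.sub_ne_zero_of_lt hi)).mul_right _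
    rw [term, tableI_of_mem_maximalIdeal hmem, term]
  obtain ⟨u, hu⟩ := D.exists_prod_det_eq hd hn
  have hq0 : (residueCard R : ℂ) ≠ 0 := by exact_mod_cast (residueCard_pos (R := R)).ne'
  have hc0 : (cardTo (residueCard R) r n : ℂ) ≠ 0 := by
    rw [cardTo]; push_cast; exact pow_ne_zero _ hq0
  rw [Finset.sum_range_succ, Finset.sum_congr rfl hterm, pow_succ, mul_assoc,
    D.zeta_iterate hπ h2 hd hs n hn.le, D.zeta_of_isUnit_const hπ h2 _ b' hunit hu hs,
    D.sum_rank_zeros hn, hdiv le_rfl, Nat.sub_self, pow_zero, one_mul, term, cardTo_succ]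
  push_cast
  field_simp
  ring

theorem rankTo_add_rankTo_succ (r : ℕ → ℕ) (k : ℕ) :
    rankTo r k + rankTo r (k + 1) = ∑ i ∈ Finset.range (k + 2), r i := by
  rw [← Finset.sum_filter_add_sum_filter_not (Finset.range (k + 2)) (fun i => i % 2 = k % 2),
    rankTo, rankTo]
  congr 1
  · refine Finset.sum_congr ?_ fun _ _ => rfl
    ext i
    simp only [Finset.mem_filter, Finset.mem_range]
    omega
  · refine Finset.sum_congr ?_ fun _ _ => rfl
    ext i
    simp only [Finset.mem_filter, Finset.mem_range]
    omega

theorem zeta_of_lin_const_eq_zero (hπ : Irreducible π) (h2 : IsUnit (2 : R))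
    (hd : ∀ i, ∃ u : Rˣ, (D.mat i).det = d i * (u : R) ^ 2) {s : ℂ} (hs : 0 < s.re) {k : ℕ}
    (hk : D.bound = k + 2) :
    zeta (D.poly π (exponent 0) 0 0) s =
      ∑ i ∈ Finset.range k, term r d ((residueCard R : ℂ) ^ (-s)) i 0 +
        (term r d ((residueCard R : ℂ) ^ (-s)) k 0 +
          term r d ((residueCard R : ℂ) ^ (-s)) (k + 1) 0) *
        (1 - ((residueCard R : ℂ) ^ (-s)) ^ 2 /
          (residueCard R : ℂ) ^ (∑ i ∈ Finset.range (k + 2), r i))⁻¹ := by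
  have hq0 : (residueCard R : ℂ) ≠ 0 := by exact_mod_cast (residueCard_pos (R := R)).ne'
  have hc0 : (cardTo (residueCard R) r k : ℂ) ≠ 0 := by
    rw [cardTo]; push_cast; exact pow_ne_zero _ hq0
  have h0 := D.zeta_iterate hπ h2 hd hs k (by omega) 0 0
  have h1 := D.zeta_exponent_step hπ h2 hd (j := k) (by omega) 0 0 hs
  have h3 := D.zeta_exponent_step hπ h2 hd (j := k + 1) (by omega) 0 0 hs
  -- No index exceeds k + 1, so from step `k` on every exponent alternates and two steps restore the
  -- polynomial. Combining `h1` and `h3` then gives a linear equation for `Z`.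
  have hper : D.poly π (exponent (k + 1 + 1)) 0 0 = D.poly π (exponent k) 0 0 := by
    refine D.poly_congr π (fun i hi => ?_) 0 0
    unfold exponent
    split_ifs <;> omega
  simp only [mul_zero] at h0 h1 h3
  have ht : ‖(residueCard R : ℂ) ^ (-s)‖ < 1 := norm_card_cpow_lt_one hs
  rw [hper] at h3
  rw [h3] at h1
  rw [h0, term, term, cardTo_succ]
  set t := (residueCard R : ℂ) ^ (-s)
  set Z := zeta (D.poly π (exponent k) 0 0) s
  rw [← rankTo_add_rankTo_succ, pow_add (residueCard R : ℂ)]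
  push_cast
  have hA : (residueCard R : ℂ) ^ rankTo r k ≠ 0 := pow_ne_zero _ hq0
  have hB : (residueCard R : ℂ) ^ rankTo r (k + 1) ≠ 0 := pow_ne_zero _ hq0
  have hAB : 1 - t ^ 2 / ((residueCard R : ℂ) ^ rankTo r k *
      (residueCard R : ℂ) ^ rankTo r (k + 1)) ≠ 0 := by
    intro h
    have h1 := congrArg norm (sub_eq_zero.mp h)
    rw [← pow_add, norm_div, norm_pow, norm_pow, norm_one, Complex.norm_natCast,
      eq_div_iff (by have := residueCard_pos (R := R); positivity), one_mul] at h1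
    have hq1 : (1 : ℝ) ≤ (residueCard R : ℝ) := by exact_mod_cast residueCard_pos (R := R)
    have h5 : ‖t‖ ^ 2 < 1 := pow_lt_one₀ (norm_nonneg _) ht two_ne_zero
    linarith [one_le_pow₀ hq1 (n := rankTo r k + rankTo r (k + 1))]
  have hZ : Z * (1 - t ^ 2 / ((residueCard R : ℂ) ^ rankTo r k *
      (residueCard R : ℂ) ^ rankTo r (k + 1))) =
      tableI 0 (rankTo r k) (discTo d k : R) t + ((residueCard R : ℂ) ^ rankTo r k)⁻¹ *
        (t * tableI 0 (rankTo r (k + 1)) (discTo d (k + 1) : R) t) := by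
    rw [mul_sub, mul_one, sub_eq_iff_eq_add]
    conv_lhs => rw [h1]
    field_simp
    ring
  congr 1
  rw [eq_mul_inv_iff_mul_eq₀ hAB, mul_assoc, hZ]
  field_simp
  ring

end FormData

/-! ### From the polynomials of the theorem to the recursion -/

section Main

variable {R σ : Type*} [CommRing R] [IsDomain R] [IsDiscreteValuationRing R]
  [HenselianLocalRing R] [Finite (ResidueField R)]
  [TopologicalSpace R] [IsTopologicalRing R] [CompactSpace R] [MeasurableSpace R]
  [BorelSpace R] [T2Space R] {π : R} [Fintype σ]

/-- A sum of scaled unimodular forms, a linear form and a constant comes from a `FormData`. -/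
theorem exists_formData (h2 : IsUnit (2 : R)) {Q : ℕ → MvPolynomial σ R} {L : MvPolynomial σ R}
    {b : R} (c : R) {r : ℕ → ℕ} {d : ℕ → Rˣ} {ω : ℕ}
    (hQ : ∀ i, IsUnimodularForm (Q i) (r i) (d i)) (hQω : ∀ i, ω < i → Q i = 0)
    (hL : IsLinearInOneVar L b) (hQQ : ∀ i j, i ≠ j → Disjoint (Q i).vars (Q j).vars)
    (hQL : ∀ i, Disjoint (Q i).vars L.vars) {N : ℕ} (hN : ω < N) :
    ∃ D : FormData R σ r, D.bound = N ∧ (D.lin = none → b = 0) ∧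
      (∀ i, ∃ u : Rˣ, (D.mat i).det = d i * (u : R) ^ 2) ∧
      ∑ i ∈ Finset.range (ω + 1), C (π ^ i) * Q i + L + C c = D.poly π (exponent 0) b c := by
  choose emb mat hsymm hform hdet using hQ
  have hunit (i : ℕ) : IsUnit (mat i).det := by
    obtain ⟨u, hu⟩ := hdet i
    rw [hu]
    exact (d i).isUnit.mul (u.isUnit.pow 2)
  have hmem (i : ℕ) (k : Fin (r i)) : emb i k ∈ (Q i).vars := by
    rw [hform]
    exact mem_vars_formOfMatrix h2 _ (hsymm i) (hunit i) k
  obtain ⟨lin, hlin, hlinL, hlinb⟩ : ∃ lin : Option σ, (∀ i k, lin ≠ some (emb i k)) ∧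
      C b * lin.elim 0 X = L ∧ (lin = none → b = 0) := by
    -- If b = 0 then L = 0 has no `vars`, and its nominal indeterminate might occur in a form; it is
    -- therefore dropped.
    by_cases hb : b = 0
    · refine ⟨none, fun _ _ => by simp, ?_, fun _ => hb⟩
      rcases hL with ⟨h, -⟩ | ⟨x, h⟩
      · simp [h]
      · simp [h, hb]
    · rcases hL with ⟨-, h⟩ | ⟨x, rfl⟩
      · exact absurd h hb
      · refine ⟨some x, fun i k h => ?_, rfl, by simp⟩
        have hx : x ∈ (C b * X x : MvPolynomial σ R).vars := by
          rw [C_mul_X_eq_monomial, vars_monomial hb]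
          simp
        rw [Option.some_inj] at h
        exact Finset.disjoint_left.mp (hQL i) (hmem i k) (h ▸ hx)
  refine ⟨⟨emb, mat, lin, N, hsymm, hunit, fun i j hij k l h => ?_, hlin⟩, rfl, hlinb, hdet, ?_⟩
  · exact Finset.disjoint_left.mp (hQQ i j hij) (hmem i k) (h ▸ hmem j l)
  · rw [FormData.poly, hlinL]
    congr 2
    simp only [exponent, Nat.zero_le, if_true, Nat.sub_zero, ← hform]
    refine Finset.sum_subset (Finset.range_mono hN) fun i _ hi => ?_
    rw [hQω i (by simpa using hi), mul_zero]

theorem zeta_form (hπ : Irreducible π) (h2 : IsUnit (2 : R))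
    {Q : ℕ → MvPolynomial σ R} {L : MvPolynomial σ R} {b c : R} {r : ℕ → ℕ} {d : ℕ → Rˣ} {ω : ℕ}
    (hω : 0 < ω) (hQ : ∀ i, IsUnimodularForm (Q i) (r i) (d i)) (hQω : ∀ i, ω < i → Q i = 0)
    (hL : IsLinearInOneVar L b) (hQQ : ∀ i j, i ≠ j → Disjoint (Q i).vars (Q j).vars)
    (hQL : ∀ i, Disjoint (Q i).vars L.vars) {s : ℂ} (hs : 0 < s.re) :
    let f : MvPolynomial σ R := ∑ i ∈ Finset.range (ω + 1), C (π ^ i) * Q i + L + C c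
    let q : ℕ := residueCard R
    let t : ℂ := (q : ℂ) ^ (-s)
    let I : ℕ → R → ℂ := term r d t
    Integrable (integrand f s) (haar R σ) ∧
    (L = 0 → c = 0 → zeta f s = ∑ i ∈ Finset.range (ω - 1), I i 0 +
      (I (ω - 1) 0 + I ω 0) * (1 - t ^ 2 / (q : ℂ) ^ (∑ i ∈ Finset.range (ω + 1), r i))⁻¹) ∧
    (∀ lam : ℕ, val b = (lam : ℕ∞) → val b ≤ val c → zeta f s =
      ∑ i ∈ Finset.range lam, I i 0 + t ^ lam / (cardTo q r lam : ℂ) * geom q t) ∧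
    (∀ κ : ℕ, val c = (κ : ℕ∞) → val c < val b → zeta f s =
      ∑ i ∈ Finset.range (κ + 1), I i (divPow π c i) + t ^ κ / (cardTo q r (κ + 1) : ℂ)) := by
  classical
  have := Fintype.ofFinite (ResidueField R)
  intro f q t I
  refine ⟨integrable_absVal_cpow hπ (measurableSet_dvd_eval hπ f) hs, ?_, ?_, ?_⟩
  · intro hL0 hc0
    have hb0 : b = 0 := by
      rcases hL with ⟨-, h⟩ | ⟨x, h⟩
      · exact h
      · rw [hL0, C_mul_X_eq_monomial, eq_comm, monomial_eq_zero] at h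
        exact h
    obtain ⟨D, hbound, -, hdet, hf⟩ :=
      exists_formData (π := π) h2 c hQ hQω hL hQQ hQL (Nat.lt_succ_self ω)
    obtain ⟨k, rfl⟩ : ∃ k, ω = k + 1 := ⟨ω - 1, by omega⟩
    simp only [f]
    rw [hf, hb0, hc0, D.zeta_of_lin_const_eq_zero hπ h2 hdet hs hbound]
    rfl
  · intro lam hb hbc
    obtain ⟨D, hbound, hlin, hdet, hf⟩ :=
      -- The family is padded by zero forms beyond `ω` so that all `lam` steps stay within the
      -- bound.
      exists_formData (π := π) h2 c hQ hQω hL hQQ hQL (show ω < ω + 1 + lam by omega)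
    simp only [f]
    rw [hf, D.zeta_of_lin_dvd_const hπ h2 hdet hs (by omega) hlin hb hbc]
  · intro κ hc hcb
    obtain ⟨D, hbound, -, hdet, hf⟩ :=
      exists_formData (π := π) h2 c hQ hQω hL hQQ hQL (show ω < ω + 1 + κ by omega)
    simp only [f]
    rw [hf, D.zeta_of_const_lt_lin hπ h2 hdet hs (by omega) hc hcb]

end Main

end Reduction

/-! ### The valuation ring of a p-adic field is Hausdorff and henselian -/

section LocalField

variable (K : Type*) [Field K] [ValuativeRel K] [TopologicalSpace K]
  [IsNonarchimedeanLocalField K]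

theorem t2Space_integer : T2Space 𝒪[K] := by
  let := IsTopologicalAddGroup.rightUniformSpace K
  have := isUniformAddGroup_of_addCommGroup (G := K)
  have : T2Space K := inferInstance
  infer_instance

theorem henselianLocalRing_integer : HenselianLocalRing 𝒪[K] := by
  let := IsTopologicalAddGroup.rightUniformSpace K
  have := isUniformAddGroup_of_addCommGroup (G := K)
  exact ⟨fun f hf a₀ h₁ h₂ => HenselianRing.is_henselian (I := 𝓂[K]) f hf a₀ h₁ (h₂.map _)⟩

end LocalField

end Igusa

theorem theorem1
    {K : Type*} [Field K] [ValuativeRel K] [TopologicalSpace K] [IsNonarchimedeanLocalField K]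
    [CharZero K] [MeasurableSpace K] [BorelSpace K]
    (p : ℕ) (hp : p.Prime) (hp_odd : Odd p) [CharP 𝓀[K] p]
    (π : 𝒪[K]) (hπ : Irreducible π)
    {σ : Type*} [Fintype σ]
    (Q : ℕ → MvPolynomial σ 𝒪[K]) (L : MvPolynomial σ 𝒪[K]) (b c : 𝒪[K])
    (r : ℕ → ℕ) (d : ℕ → 𝒪[K]ˣ) (ω : ℕ) (hω : 0 < ω)
    (hQ : ∀ i, Igusa.IsUnimodularForm (Q i) (r i) (d i))
    (hQω : ∀ i, ω < i → Q i = 0)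
    (hL : Igusa.IsLinearInOneVar L b)
    (hQQ : ∀ i j, i ≠ j → Disjoint (Q i).vars (Q j).vars)
    (hQL : ∀ i, Disjoint (Q i).vars L.vars)
    (s : ℂ) (hs : 0 < s.re) :
    let f : MvPolynomial σ 𝒪[K] :=
      ∑ i ∈ Finset.range (ω + 1), MvPolynomial.C (π ^ i) * Q i + L + MvPolynomial.C c
    let q : ℕ := Igusa.residueCard 𝒪[K]
    let t : ℂ := (q : ℂ) ^ (-s)
    let I : ℕ → 𝒪[K] → ℂ := Igusa.term r d t
    MeasureTheory.Integrable (Igusa.integrand f s) (Igusa.haar 𝒪[K] σ) ∧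
    (L = 0 → c = 0 →
      Igusa.zeta f s =
        ∑ i ∈ Finset.range (ω - 1), I i 0
          + (I (ω - 1) 0 + I ω 0)
            * (1 - t ^ 2 / (q : ℂ) ^ (∑ i ∈ Finset.range (ω + 1), r i))⁻¹) ∧
    (∀ lam : ℕ, Igusa.val b = (lam : ℕ∞) → Igusa.val b ≤ Igusa.val c →
      Igusa.zeta f s =
        ∑ i ∈ Finset.range lam, I i 0
          + t ^ lam / (Igusa.cardTo q r lam : ℂ) * Igusa.geom q t) ∧
    (∀ κ : ℕ, Igusa.val c = (κ : ℕ∞) → Igusa.val c < Igusa.val b →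
      Igusa.zeta f s =
        ∑ i ∈ Finset.range (κ + 1), I i (Igusa.divPow π c i)
          + t ^ κ / (Igusa.cardTo q r (κ + 1) : ℂ)) := by
  have h2 : IsUnit (2 : 𝒪[K]) := by
    rw [← IsLocalRing.residue_ne_zero_iff_isUnit, map_ofNat]
    have hp2 : ringChar 𝓀[K] ≠ 2 := by
      rw [ringChar.eq 𝓀[K] p]
      rintro rfl
      exact absurd hp_odd (by decide)
    exact Ring.two_ne_zero hp2
  have := Igusa.t2Space_integer K
  have := Igusa.henselianLocalRing_integer K
  exact Igusa.zeta_form hπ h2 hω hQ hQω hL hQQ hQL hs
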